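/- Let $n\ge 1$ and $0\le k\le n$. Let $\Lambda^k$ be the space of complex-valued alternating $k$-forms on $\mathbb R^n$, let $\mathcal S\mathcal E^k(\mathbb R^n)$ be the space of differential $k$-forms on $\mathbb R^n$ with Schwartz coefficients, let $\iota_x$ be the interior product with $x$, and let $\varepsilon_x\omega=x^*\wedge\omega$ where $x^*=\langle x,\cdot\rangle$ ($\iota_x=0$ on $\Lambda^0$). For $s\in\mathbb C$ with $-n<\operatorname{Re}s<0$ and $\omega\in\mathcal S\mathcal E^k(\mathbb R^n)$ put $$\langle \mathcal R_s^k,\omega\rangle=\pi^{-\frac n2}\,2^{-s-n+1}\,\frac{\Gamma(1-\frac s2)}{\Gamma(\frac{s+n}2)}\int_{\mathbb R^n}\|x\|^{s-2}\,(\iota_x\varepsilon_x-\varepsilon_x\iota_x)\,\omega(x)\,dx\ \in\Lambda^k .$$ Then $s\mapsto\mathcal R_s^k$ extends uniquely to a (weakly) meromorphic family of $\Lambda^k$-valued tempered distributions on $\mathbb C$, holomorphic outside $\{2,4,6,\dots\}$ (at these points, where the factor $\Gamma(1-\frac s2)$ has its poles, the value is set to $0$ by convention). For $\lambda\in\mathbb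 C$ let $I_\lambda^k$ be the Knapp–Stein operator, that is, convolution with $\mathcal R^k_{-2n+2\lambda}$: $$I_\lambda^k\omega(x)=\int_{\mathbb R^n}\mathcal R^k_{-2n+2\lambda}(x-y)\,\omega(y)\,dy=\langle\mathcal R^k_{-2n+2\lambda},\,\omega(x-\cdot)\rangle,\qquad \omega\in\mathcal S\mathcal E^k(\mathbb R^n),\ x\in\mathbb R^n .$$ For generic $\lambda$, namely for every $\lambda\in\mathbb C$ with $\lambda\ne k$, $\lambda\ne n-k$ and $\lambda\notin\{n+1,n+2,n+3,\dots\}$, the operator $I_\lambda^k$ is injective on $\mathcal S\mathcal E^k(\mathbb R^n)$. -/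

import Mathlib

open scoped SchwartzMap

noncomputable section

namespace KnappSteinForms

/-- The Euclidean space `ℝⁿ`. -/
abbrev Eucl (n : ℕ) : Type := EuclideanSpace ℝ (Fin n)

/-- `Λᵏ`: complex-valued alternating `k`-forms on `ℝⁿ`. -/
abbrev AltForm (n k : ℕ) : Type := (Eucl n) [⋀^Fin k]→L[ℝ] ℂ

/-- Differential `k`-forms on `ℝⁿ` with Schwartz coefficients. -/
abbrev SchwartzForm (n k : ℕ) : Type := 𝓢(Eucl n, AltForm n k)

/-- Interior product: `(ι_x ω)(x₁, …, x_k) = ω(x, x₁, …, x_k)`. -/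
def intProd {n k : ℕ} (x : Eucl n) (ω : AltForm n (k + 1)) : AltForm n k :=
  ω.curryLeft x

/-- Exterior product with the linear form `x* = ⟨x, ·⟩`:
`(x* ∧ ω)(v₀, …, v_k) = ∑ i, (-1)^i ⟨x, v_i⟩ ω(v₀, …, v̂_i, …, v_k)`. -/
def extProd {n k : ℕ} (x : Eucl n) (ω : AltForm n k) : AltForm n (k + 1) :=
  ContinuousAlternatingMap.alternatizeUncurryFin ((innerSL ℝ x).smulRight ω)

theorem extProd_apply {n k : ℕ} (x : Eucl n) (ω : AltForm n k) (v : Fin (k + 1) → Eucl n) :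
    extProd x ω v =
      ∑ i : Fin (k + 1), (-1 : ℤ) ^ (i : ℕ) • (inner ℝ x (v i) • ω (i.removeNth v)) := by
  simp [extProd, ContinuousAlternatingMap.alternatizeUncurryFin_apply]

/-- The endomorphism `ι_x ε_x` of `Λᵏ`. -/
def intExt {n k : ℕ} (x : Eucl n) (ω : AltForm n k) : AltForm n k :=
  intProd x (extProd x ω)

/-- The endomorphism `ε_x ι_x` of `Λᵏ`; it is zero for `k = 0`, where `ι_x = 0`. -/
def extInt {n : ℕ} : {k : ℕ} → Eucl n → AltForm n k → AltForm n k
  | 0, _, _ => 0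
  | _ + 1, x, ω => extProd x (intProd x ω)

/-- The factor `π^{-n/2} 2^{-s-n+1} Γ(1 - s/2) / Γ((s+n)/2)`. -/
def rieszFactor (n : ℕ) (s : ℂ) : ℂ :=
  (Real.pi : ℂ) ^ (-(n : ℂ) / 2) * 2 ^ (-s - n + 1) *
    (Complex.Gamma (-s / 2 + 1) / Complex.Gamma ((s + n) / 2))

/-- The integral that defines the Riesz distribution `R_s^k` on differential forms in the strip
`-n < Re s < 0`. -/
def rieszIntegral (n k : ℕ) (s : ℂ) (ω : SchwartzForm n k) : AltForm n k :=
  rieszFactor n s •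
    ∫ x : Eucl n, ((‖x‖ : ℂ) ^ (s - 2)) • (intExt x (ω x) - extInt x (ω x))

/-- The points `2, 4, 6, …`, which are the poles of the factor `Γ(1 - s/2)`. -/
def rieszPoles : Set ℂ := {s | ∃ m : ℕ, s = 2 * ((m : ℂ) + 1)}

/-- `R` is the meromorphic continuation to `ℂ` of the family of `Λᵏ`-valued tempered distributions
given by `rieszIntegral` in the strip `-n < Re s < 0`. It is holomorphic outside `rieszPoles`;
by convention the value at a point of `rieszPoles` is `0`. -/
structure IsRieszFamily (n k : ℕ) (R : ℂ → (SchwartzForm n k →L[ℂ] AltForm n k)) : Prop where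
  eq_integral : ∀ s : ℂ, -(n : ℝ) < s.re → s.re < 0 → ∀ ω, R s ω = rieszIntegral n k s ω
  analyticAt : ∀ ω, ∀ s ∉ rieszPoles, AnalyticAt ℂ (fun z => R z ω) s
  meromorphicAt : ∀ ω, ∀ s ∈ rieszPoles, MeromorphicAt (fun z => R z ω) s
  eq_zero : ∀ s ∈ rieszPoles, R s = 0

open Classical in
/-- The Riesz distributions `R_s^k` on differential forms, `s ∈ ℂ`. -/
def riesz (n k : ℕ) : ℂ → (SchwartzForm n k →L[ℂ] AltForm n k) :=
  if h : ∃ R, IsRieszFamily n k R then h.choose else 0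

/-- For a Schwartz form `ω` and a point `x`, the Schwartz form `y ↦ ω (x - y)`. -/
def reflTranslate (n k : ℕ) (x : Eucl n) : SchwartzForm n k →L[ℂ] SchwartzForm n k :=
  (SchwartzMap.compSubConstCLM ℂ x).comp
    (SchwartzMap.compCLMOfContinuousLinearEquiv ℂ (ContinuousLinearEquiv.neg ℝ))

theorem reflTranslate_apply (n k : ℕ) (x : Eucl n) (ω : SchwartzForm n k) (y : Eucl n) :
    reflTranslate n k x ω y = ω (x - y) := by
  simp [reflTranslate]

/-- The Knapp–Stein operator `I_λ^k`: convolution with the tempered distribution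
`R_{-2n+2λ}^k`, that is `(I_λ^k ω)(x) = ⟨R_{-2n+2λ}^k, ω(x - ·)⟩`. -/
def knappStein (n k : ℕ) (l : ℂ) : SchwartzForm n k →ₗ[ℂ] (Eucl n → AltForm n k) :=
  LinearMap.pi fun x =>
    ((riesz n k (-2 * (n : ℂ) + 2 * l)).comp (reflTranslate n k x)).toLinearMap

end KnappSteinForms

end

noncomputable section

namespace KnappSteinForms

/-! ### Algebra of the symbol `ι_x ε_x - ε_x ι_x` -/

section Symbol

variable {n k : ℕ}

/-! Write `σ(x) = ι_x ε_x - ε_x ι_x`. It is quadratic in `x`, satisfies `σ(x)² = ‖x‖⁴`, and the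
diagonal of its coefficients sums to `n - 2k` times the identity (`symbol_symbol`,
`sum_symbolCoeff_self`).

The diagonal sum determines the Fourier transform of the kernel. Pairing with Gaussians of width `t`
gives a theta function whose behaviour under `t ↦ 1/t` comes from Parseval and integration by parts
(`theta_quadMap`). Its Mellin transform yields `functional_equation`: after normalization,
`‖x‖^(s-2) σ(x)` has Fourier transform, up to a nowhere vanishing entire factor, `‖ξ‖^(-n-s-2)
P_s(ξ)` with `P_s(ξ) = (n - 2k)‖ξ‖² - (n + s) σ(ξ)`.

Existence: the position integral makes sense for `Re s > -n` and the frequency integral for `Re s <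
0`. They agree on the overlap, and the two half-planes cover `ℂ` (`exists_isRieszFamily`).
Uniqueness is the identity theorem.

Injectivity: since `σ² = ‖ξ‖⁴`, `P_s(ξ)` is invertible for `ξ ≠ 0` unless `n - 2k = ±(n + s)`, which
for `s = -2n + 2λ` means `λ = n - k` or `λ = k`. When `Re s ≥ 0` the frequency kernel may be
singular at the origin, so the form is first replaced by an iterated difference, whose Fourier
transform vanishes there to high order. The frequency formula persists for such forms, Fourier
inversion kills the difference, and varying its step recovers the form
(`eq_zero_of_forall_translate_eq_zero`). -/

theorem intExt_add_extInt (x : Eucl n) (ω : AltForm n k) :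
    intExt x ω + extInt x ω = (‖x‖ ^ 2) • ω := by
  cases k with
  | zero =>
    ext v
    simp only [extInt, add_zero, intExt, intProd, ContinuousAlternatingMap.curryLeft_apply_apply,
      extProd_apply]
    have : Fin.removeNth 0 (Matrix.vecCons x v) = v := by ext i; exact i.elim0
    simp [this]
  | succ k =>
    ext v
    simp only [extInt, intExt, intProd, ContinuousAlternatingMap.curryLeft_apply_apply,
      extProd_apply, ContinuousAlternatingMap.add_apply]
    rw [Fin.sum_univ_succ]
    have h0 : Fin.removeNth 0 (Matrix.vecCons x v) = v := by ext i; simp [Fin.removeNth]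
    have h (i : Fin (k + 1)) : Fin.removeNth i.succ (Matrix.vecCons x v)
        = Matrix.vecCons x (i.removeNth v) := by
      ext j
      refine Fin.cases ?_ (fun j => ?_) j
      · simp [Fin.removeNth]
      · simp [Fin.removeNth, Fin.succ_succAbove_succ]
    simp only [h0, h]
    simp [pow_succ]

theorem intProd_intProd (x : Eucl n) (ω : AltForm n (k + 2)) : intProd x (intProd x ω) = 0 :=
  ContinuousAlternatingMap.curryLeft_same ω x

/-- Apply `ι_x ε_x + ε_x ι_x = ‖x‖²` to `ι_x ω`; the second summand drops out because `ι_x² = 0`.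
Hence `ε_x ι_x` is `‖x‖²` times a projection. -/
theorem extInt_extInt (x : Eucl n) (ω : AltForm n k) :
    extInt x (extInt x ω) = (‖x‖ ^ 2) • extInt x ω := by
  cases k with
  | zero => exact (smul_zero (A := AltForm n 0) (‖x‖ ^ 2)).symm
  | succ k =>
    have h := intExt_add_extInt x (intProd x ω)
    have h0 : extInt x (intProd x ω) = 0 := by
      cases k with
      | zero => rfl
      | succ k =>
        simp only [extInt, intProd_intProd]
        ext v; simp [extProd_apply]
    rw [h0, add_zero] at h
    change extProd x (intExt x (intProd x ω)) = _
    rw [h]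
    ext v
    simp [extInt, extProd_apply, Finset.mul_sum, mul_left_comm]

/-- The bilinear version `ω ↦ a* ∧ ι_b ω` of `ε_x ι_x`, as a continuous linear map. -/
def extIntBilin : {k : ℕ} → (a b : Eucl n) → AltForm n k →L[ℂ] AltForm n k
  | 0, _, _ => 0
  | k + 1, a, b =>
    { toFun := fun ω => extProd a (intProd b ω)
      map_add' := fun ω η => by
        ext v; simp [extProd_apply, intProd, Finset.sum_add_distrib]
      map_smul' := fun c ω => by
        ext v; simp [extProd_apply, intProd, Finset.mul_sum, mul_left_comm]
      cont := by
        have : Continuous fun ω : AltForm n (k + 1) =>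
            ContinuousAlternatingMap.alternatizeUncurryFinCLM ℝ (Eucl n) ℂ
              ((innerSL ℝ a).smulRight (ω.curryLeft b)) := by
          have h1 : Continuous fun ω : AltForm n (k + 1) => ω.curryLeft b :=
            ((ContinuousAlternatingMap.curryLeftLI (𝕜 := ℝ) (E := Eucl n) (F := ℂ)
              (n := k)).continuous).clm_apply continuous_const
          exact (ContinuousLinearMap.continuous _).comp
            ((ContinuousLinearMap.smulRightL ℝ (Eucl n) (AltForm n k)
              (innerSL ℝ a)).continuous.comp h1)
        exact this }

theorem extIntBilin_self (x : Eucl n) (ω : AltForm n k) : extIntBilin x x ω = extInt x ω := by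
  cases k <;> rfl

theorem extIntBilin_eq_sum (x : Eucl n) (ω : AltForm n k) :
    extInt x ω = ∑ i, ∑ j, ((x i : ℂ) * (x j : ℂ)) •
      extIntBilin (EuclideanSpace.single i (1 : ℝ)) (EuclideanSpace.single j (1 : ℝ)) ω := by
  cases k with
  | zero => exact (Finset.sum_eq_zero fun i _ => Finset.sum_eq_zero fun j _ => smul_zero _).symm
  | succ k =>
    have h1 (y : Eucl n) (η : AltForm n k) : extProd y η
        = ∑ i, y i • extProd (EuclideanSpace.single i (1 : ℝ)) η := by
      ext v
      simp only [extProd_apply, ContinuousAlternatingMap.sum_apply,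
        ContinuousAlternatingMap.smul_apply, Finset.smul_sum]
      rw [Finset.sum_comm]
      refine Finset.sum_congr rfl fun a _ => ?_
      have : inner ℝ y (v a) = ∑ i, y i * inner ℝ (EuclideanSpace.single i (1 : ℝ)) (v a) := by
        simp [PiLp.inner_apply, mul_comm]
      rw [this, Finset.sum_smul, Finset.smul_sum]
      exact Finset.sum_congr rfl fun i _ => by rw [mul_smul, smul_comm]
    have h2 (y : Eucl n) : intProd y ω
        = ∑ i, y i • intProd (EuclideanSpace.single i (1 : ℝ)) ω := by
      have hy : y = ∑ i, y i • EuclideanSpace.single i (1 : ℝ) := by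
        ext j; simp [Finset.sum_apply, Pi.single_apply]
      conv_lhs => rw [hy]
      simp [intProd]
    simp only [extInt]
    rw [h1]
    refine Finset.sum_congr rfl fun i _ => ?_
    rw [h2]
    change _ = ∑ j, ((x i : ℂ) * (x j : ℂ)) • extProd _ (intProd _ ω)
    ext v
    simp [extProd_apply, Finset.mul_sum]
    rw [Finset.sum_comm]
    simp [mul_assoc, mul_left_comm]

/-- `∑ e_i* ∧ ι_{e_i}` is the degree operator: it alternates the curried form `x ↦ ι_x ω`, and
alternating an already alternating `k`-form multiplies it by `k`. -/
theorem sum_extInt_single (ω : AltForm n k) :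
    ∑ i, extInt (EuclideanSpace.single i (1 : ℝ)) ω = (k : ℂ) • ω := by
  cases k with
  | zero => 
    rw [Nat.cast_zero]
    exact (Finset.sum_eq_zero fun i _ => rfl).trans (zero_smul ℂ ω).symm
  | succ k =>
    simp only [extInt, extProd, intProd]
    have := ContinuousAlternatingMap.alternatizeUncurryFin_curryLeft ω
    have h : ω.curryLeft = ∑ i, (innerSL ℝ (EuclideanSpace.single i (1 : ℝ))).smulRight
        (ω.curryLeft (EuclideanSpace.single i (1 : ℝ))) := by
      ext1 x
      have hx : x = ∑ i, x i • EuclideanSpace.single i (1 : ℝ) := by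
        ext j; simp [Finset.sum_apply, Pi.single_apply]
      conv_lhs => rw [hx]
      simp [-ContinuousAlternatingMap.curryLeft_apply_apply, EuclideanSpace.inner_single_left]
    have h3 := congrArg (ContinuousAlternatingMap.alternatizeUncurryFinCLM ℝ (Eucl n) ℂ) h
    rw [map_sum] at h3
    simp only [ContinuousAlternatingMap.alternatizeUncurryFinCLM_apply] at h3
    rw [← h3, this]
    ext v
    simp

/-- The coefficients of the quadratic map `x ↦ ι_x ε_x - ε_x ι_x`. -/
def symbolCoeff (n k : ℕ) (i j : Fin n) : AltForm n k →L[ℂ] AltForm n k :=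
  (if i = j then ContinuousLinearMap.id ℂ _ else 0) -
    (2 : ℂ) • extIntBilin (EuclideanSpace.single i (1 : ℝ)) (EuclideanSpace.single j (1 : ℝ))

/-- The operator-valued quadratic map with coefficients `L`. -/
def quadMap {V : Type*} [NormedAddCommGroup V] [NormedSpace ℂ V]
    (L : Fin n → Fin n → V →L[ℂ] V) (x : Eucl n) : V →L[ℂ] V :=
  ∑ i, ∑ j, ((x i : ℂ) * (x j : ℂ)) • L i j

/-- The quadratic map `x ↦ ι_x ε_x - ε_x ι_x` with values in the endomorphisms of `Λᵏ`. -/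
abbrev symbol (n k : ℕ) : Eucl n → AltForm n k →L[ℂ] AltForm n k :=
  quadMap (symbolCoeff n k)

theorem sum_sq_eq_norm_sq (x : Eucl n) : ∑ i, (x i : ℂ) * (x i : ℂ) = (‖x‖ : ℂ) ^ 2 := by
  rw [← Complex.ofReal_pow, EuclideanSpace.real_norm_sq_eq]
  push_cast
  exact Finset.sum_congr rfl fun i _ => by ring

theorem symbol_apply_eq (x : Eucl n) (ω : AltForm n k) :
    symbol n k x ω = (‖x‖ : ℂ) ^ 2 • ω - (2 : ℂ) • extInt x ω := by
  simp only [symbol, quadMap, symbolCoeff, sum_apply, smul_apply,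
    sub_apply, smul_sub, Finset.sum_sub_distrib]
  have e : (∑ i, (x i : ℂ) * (x i : ℂ)) • ω = ∑ i, ((x i : ℂ) * (x i : ℂ)) • ω :=
    by ext v; simp [Finset.sum_mul]
  rw [extIntBilin_eq_sum, ← sum_sq_eq_norm_sq, Finset.smul_sum, e]
  congr 1
  · refine Finset.sum_congr rfl fun i _ => ?_
    rw [Finset.sum_eq_single i (fun j _ hj => by
      rw [if_neg hj.symm]; exact smul_zero (M := ℂ) (A := AltForm n k) _) (by simp)]
    simp
  · refine Finset.sum_congr rfl fun i _ => ?_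
    rw [Finset.smul_sum]
    exact Finset.sum_congr rfl fun j _ => smul_comm _ _ _

theorem symbol_apply (x : Eucl n) (ω : AltForm n k) :
    symbol n k x ω = intExt x ω - extInt x ω := by
  rw [symbol_apply_eq, eq_sub_of_add_eq (intExt_add_extInt x ω)]
  ext v; simp; ring

/-- `σ = ‖x‖² - 2E` with `E² = ‖x‖² E`, so `σ` is `‖x‖²` times a reflection. -/
theorem symbol_symbol (x : Eucl n) (ω : AltForm n k) :
    symbol n k x (symbol n k x ω) = (‖x‖ : ℂ) ^ 4 • ω := by
  have h (c : ℂ) (η θ : AltForm n k) : extInt x (c • η - (2 : ℂ) • θ)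
      = c • extInt x η - (2 : ℂ) • extInt x θ := by
    simp [← extIntBilin_self]
  rw [symbol_apply_eq, symbol_apply_eq, h, extInt_extInt]
  ext v; simp; ring

theorem sum_symbolCoeff_self (n k : ℕ) :
    ∑ i, symbolCoeff n k i i = ((n : ℂ) - 2 * k) • ContinuousLinearMap.id ℂ (AltForm n k) := by
  ext1 ω
  simp only [symbolCoeff, sum_apply, if_true, sub_apply,
    smul_apply, Finset.sum_sub_distrib, ← Finset.smul_sum,
    extIntBilin_self, sum_extInt_single]
  ext v; simp; ring

end Symbol

/-! ### Integrals against powers of the norm -/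

section Weights

open MeasureTheory Set Filter Topology

variable {n : ℕ} {V : Type*} [NormedAddCommGroup V] [NormedSpace ℂ V]

/-- In polar coordinates the radial exponent is `σ + n - 1 > -1` near `0` and effectively `σ + n - 1
- N < -1` at infinity. -/
theorem integrable_norm_rpow_mul_one_add_norm [NeZero n] {σ : ℝ} (hσ : -(n : ℝ) < σ) {N : ℕ}
    (hN : σ + n < N) :
    Integrable (fun x : Eucl n => ‖x‖ ^ σ * ((1 + ‖x‖) ^ N)⁻¹) := by
  have hn : 1 ≤ n := NeZero.one_le
  rw [integrable_fun_norm_addHaar volume (f := fun y : ℝ => y ^ σ * ((1 + y) ^ N)⁻¹),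
    ← Ioc_union_Ioi_eq_Ioi zero_le_one]
  simp only [finrank_euclideanSpace, Fintype.card_fin, smul_eq_mul]
  have key (y : ℝ) (hy : 0 < y) : y ^ (n - 1) * (y ^ σ * ((1 + y) ^ N)⁻¹)
      = y ^ (σ + n - 1) * ((1 + y) ^ N)⁻¹ := by
    rw [← mul_assoc, ← Real.rpow_natCast, ← Real.rpow_add hy]
    push_cast [hn]
    ring_nf
  have hm : Measurable fun y : ℝ => y ^ (n - 1) * (y ^ σ * ((1 + y) ^ N)⁻¹) := by fun_prop
  refine IntegrableOn.union ?_ ?_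
  · have h : IntegrableOn (fun y : ℝ => y ^ (σ + n - 1)) (Ioc 0 1) := by
      rw [← intervalIntegrable_iff_integrableOn_Ioc_of_le zero_le_one]
      exact intervalIntegral.intervalIntegrable_rpow' (by linarith)
    refine Integrable.mono' h hm.aestronglyMeasurable ?_
    filter_upwards [ae_restrict_mem measurableSet_Ioc] with y hy
    have h0 : 0 < y := hy.1
    rw [key y h0, Real.norm_of_nonneg (by positivity)]
    exact mul_le_of_le_one_right (by positivity)
      (inv_le_one_of_one_le₀ (one_le_pow₀ (by linarith)))
  · have h : IntegrableOn (fun y : ℝ => y ^ (σ + n - 1 - N)) (Ioi 1) :=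
      integrableOn_Ioi_rpow_of_lt (by linarith) one_pos
    refine Integrable.mono' h hm.aestronglyMeasurable ?_
    filter_upwards [ae_restrict_mem measurableSet_Ioi] with y hy
    have h0 : 0 < y := one_pos.trans hy
    rw [key y h0, Real.norm_of_nonneg (by positivity), Real.rpow_sub h0 (σ + n - 1), Real.rpow_natCast,
      div_eq_mul_inv]
    gcongr
    linarith

/-- Rapidly decreasing functions that vanish to order `m` at the origin. -/
structure IsRapid (m : ℕ) (g : Eucl n → V) : Prop where
  aestronglyMeasurable : AEStronglyMeasurable g volume
  bound : ∀ N : ℕ, ∃ C : ℝ, ∀ x, (1 + ‖x‖) ^ N * ‖g x‖ ≤ C * ‖x‖ ^ m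

theorem ae_ne_zero [NeZero n] : ∀ᵐ x : Eucl n, x ≠ 0 := by
  simp [ae_iff, measure_singleton]

theorem norm_cpow_smul {x : Eucl n} (hx : x ≠ 0) (z : ℂ) (v : V) :
    ‖(‖x‖ : ℂ) ^ z • v‖ = ‖x‖ ^ z.re * ‖v‖ := by
  rw [norm_smul, Complex.norm_cpow_eq_rpow_re_of_pos (norm_pos_iff.2 hx)]

omit [NormedSpace ℂ V] in
theorem IsRapid.integrable_rpow_mul [NeZero n] {m : ℕ} {g : Eucl n → V} (hg : IsRapid m g) {σ : ℝ}
    (hσ : -(n : ℝ) < σ + m) : Integrable (fun x => ‖x‖ ^ σ * ‖g x‖) := by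
  obtain ⟨N, hN⟩ := exists_nat_gt (σ + m + n)
  obtain ⟨C, hC⟩ := hg.bound N
  refine Integrable.mono' ((integrable_norm_rpow_mul_one_add_norm hσ hN).const_mul C) ?_ ?_
  · exact (by fun_prop : Measurable fun x : Eucl n => ‖x‖ ^ σ).aestronglyMeasurable.mul
      hg.aestronglyMeasurable.norm
  · filter_upwards [ae_ne_zero] with x hx
    have h0 : 0 < ‖x‖ := norm_pos_iff.2 hx
    rw [Real.norm_of_nonneg (by positivity), Real.rpow_add h0, Real.rpow_natCast]
    have h1 : ‖g x‖ ≤ C * ‖x‖ ^ m * ((1 + ‖x‖) ^ N)⁻¹ := by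
      rw [← div_eq_mul_inv, le_div_iff₀ (by positivity), mul_comm]
      exact hC x
    calc ‖x‖ ^ σ * ‖g x‖ ≤ ‖x‖ ^ σ * (C * ‖x‖ ^ m * ((1 + ‖x‖) ^ N)⁻¹) := by gcongr
      _ = _ := by ring

theorem IsRapid.aestronglyMeasurable_cpow_smul {m : ℕ} {g : Eucl n → V} (hg : IsRapid m g) (z : ℂ) :
    AEStronglyMeasurable (fun x => (‖x‖ : ℂ) ^ z • g x) volume :=
  (by fun_prop : Measurable fun x : Eucl n => (‖x‖ : ℂ) ^ z).aestronglyMeasurable.smul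
    hg.aestronglyMeasurable

theorem IsRapid.integrable_cpow_smul [NeZero n] {m : ℕ} {g : Eucl n → V} (hg : IsRapid m g) {z : ℂ}
    (hz : -(n : ℝ) < z.re + m) : Integrable (fun x => (‖x‖ : ℂ) ^ z • g x) := by
  refine Integrable.mono' (hg.integrable_rpow_mul hz) (hg.aestronglyMeasurable_cpow_smul z) ?_
  filter_upwards [ae_ne_zero] with x hx
  rw [norm_cpow_smul hx]

theorem rpow_le_add_rpow {r a b c : ℝ} (hr : 0 < r) (hab : a ≤ b) (hbc : b ≤ c) :
    r ^ b ≤ r ^ a + r ^ c := by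
  rcases le_total 1 r with h | h
  · exact (Real.rpow_le_rpow_of_exponent_le h hbc).trans (le_add_of_nonneg_left (by positivity))
  · exact (Real.rpow_le_rpow_of_exponent_ge hr h hab).trans (le_add_of_nonneg_right (by positivity))

theorem abs_log_le_rpow {r δ : ℝ} (hr : 0 < r) (hδ : 0 < δ) :
    |Real.log r| ≤ (r ^ δ + r ^ (-δ)) / δ := by
  have h1 := Real.log_le_rpow_div hr.le hδ
  have h2 := Real.log_le_rpow_div (inv_pos.2 hr).le hδ
  rw [Real.log_inv, Real.inv_rpow hr.le, ← Real.rpow_neg hr.le] at h2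
  have h3 : 0 < r ^ δ / δ := by positivity
  have h4 : 0 < r ^ (-δ) / δ := by positivity
  rw [add_div, abs_le]
  constructor <;> linarith

/-- Integrals against `‖x‖ ^ z` depend holomorphically on `z`. -/
theorem IsRapid.differentiableAt_integral [NeZero n] {m : ℕ} {g : Eucl n → V} (hg : IsRapid m g)
    {z₀ : ℂ} (hz : -(n : ℝ) < z₀.re + m) :
    DifferentiableAt ℂ (fun z => ∫ x : Eucl n, (‖x‖ : ℂ) ^ z • g x) z₀ := by
  -- One `δ` is spent on the radius of the ball and one on the logarithm; a third of the gap keeps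
  -- the lowest exponent `Re z₀ - 2δ` integrable.
  set δ : ℝ := (z₀.re + m + n) / 3 with hδ
  have hδ0 : 0 < δ := by linarith
  have hint := (((hg.integrable_rpow_mul (σ := z₀.re - δ + δ) (by linarith)).add
    (hg.integrable_rpow_mul (σ := z₀.re - δ - δ) (by linarith))).add
    ((hg.integrable_rpow_mul (σ := z₀.re + δ + δ) (by linarith)).add
    (hg.integrable_rpow_mul (σ := z₀.re + δ - δ) (by linarith)))).div_const δ
  refine (hasDerivAt_integral_of_dominated_loc_of_deriv_le (Metric.ball_mem_nhds z₀ hδ0)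
    (Eventually.of_forall fun z => hg.aestronglyMeasurable_cpow_smul z)
    (hg.integrable_cpow_smul hz)
    (F' := fun z x => ((‖x‖ : ℂ) ^ z * Complex.log ‖x‖) • g x) ?_ ?_ hint ?_).2.differentiableAt
  · exact (by fun_prop : Measurable fun x : Eucl n =>
      (‖x‖ : ℂ) ^ z₀ * Complex.log ‖x‖).aestronglyMeasurable.smul hg.aestronglyMeasurable
  · filter_upwards [ae_ne_zero] with x hx z hzb
    have h0 : 0 < ‖x‖ := norm_pos_iff.2 hx
    have hre : |z.re - z₀.re| < δ := by
      rw [← Complex.sub_re]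
      exact (Complex.abs_re_le_norm _).trans_lt (by simpa [dist_eq_norm] using hzb)
    rw [abs_lt] at hre
    have h1 := rpow_le_add_rpow h0 (a := z₀.re - δ) (b := z.re) (c := z₀.re + δ)
      (by linarith) (by linarith)
    rw [mul_smul, norm_cpow_smul hx, norm_smul, ← Complex.ofReal_log h0.le, Complex.norm_real,
      Real.norm_eq_abs]
    calc ‖x‖ ^ z.re * (|Real.log ‖x‖| * ‖g x‖)
        ≤ (‖x‖ ^ (z₀.re - δ) + ‖x‖ ^ (z₀.re + δ)) *
          ((‖x‖ ^ δ + ‖x‖ ^ (-δ)) / δ * ‖g x‖) := by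
          gcongr
          exact abs_log_le_rpow h0 hδ0
      _ = _ := by
          simp only [Pi.add_apply, sub_eq_add_neg, Real.rpow_add h0]
          ring
  · filter_upwards [ae_ne_zero] with x hx z _
    have h0 : (‖x‖ : ℂ) ≠ 0 := by simpa using hx
    have := ((hasDerivAt_id z).const_cpow (c := (‖x‖ : ℂ)) (Or.inl h0)).smul_const (g x)
    simpa using this

theorem exists_schwartz_bound (φ : 𝓢(Eucl n, V)) (N : ℕ) :
    ∃ C : ℝ, ∀ x, (1 + ‖x‖) ^ N * ‖φ x‖ ≤ C :=
  ⟨_, fun x => by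
    simpa using SchwartzMap.one_add_le_sup_seminorm_apply (𝕜 := ℝ) (m := (N, 0)) (k := N) (n := 0)
      le_rfl le_rfl φ x⟩

/-- A Schwartz function vanishing to order `m` at `0`, multiplied by a continuous
operator-valued function that is homogeneously bounded of degree `d`. -/
theorem isRapid_clm_apply {m d : ℕ} {A : Eucl n → V →L[ℂ] V} (hA : Continuous A)
    {K : ℝ} (hK : ∀ x, ‖A x‖ ≤ K * ‖x‖ ^ d) (φ : 𝓢(Eucl n, V)) {D : ℝ}
    (hφ : ∀ x, ‖φ x‖ ≤ D * ‖x‖ ^ m) : IsRapid (m + d) (fun x => A x (φ x)) := by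
  refine ⟨(hA.clm_apply φ.continuous).aestronglyMeasurable, fun N => ?_⟩
  obtain ⟨C, hC⟩ := exists_schwartz_bound φ N
  have hK0 (x : Eucl n) : 0 ≤ K * ‖x‖ ^ d := (norm_nonneg _).trans (hK x)
  have hD0 (x : Eucl n) : 0 ≤ D * ‖x‖ ^ m := (norm_nonneg _).trans (hφ x)
  have hC0 : 0 ≤ C := le_trans (by positivity) (hC 0)
  -- Inside the unit ball use the order of vanishing; outside, `1 ≤ ‖x‖ ^ m` and Schwartz decay
  -- suffices.
  have h1 (x : Eucl n) : (1 + ‖x‖) ^ N * ‖φ x‖ ≤ (2 ^ N * D + C) * ‖x‖ ^ m := by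
    rw [add_mul, mul_assoc]
    rcases le_total ‖x‖ 1 with h | h
    · calc (1 + ‖x‖) ^ N * ‖φ x‖ ≤ (1 + 1) ^ N * (D * ‖x‖ ^ m) := by
            gcongr
            exact hφ x
        _ = 2 ^ N * (D * ‖x‖ ^ m) := by norm_num
        _ ≤ _ := le_add_of_nonneg_right (by positivity)
    · calc (1 + ‖x‖) ^ N * ‖φ x‖ ≤ C := hC x
        _ ≤ C * ‖x‖ ^ m := le_mul_of_one_le_right hC0 (one_le_pow₀ h)
        _ ≤ _ := le_add_of_nonneg_left (mul_nonneg (by positivity) (hD0 x))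
  refine ⟨(2 ^ N * D + C) * K, fun x => ?_⟩
  calc (1 + ‖x‖) ^ N * ‖A x (φ x)‖ ≤ (1 + ‖x‖) ^ N * (K * ‖x‖ ^ d * ‖φ x‖) := by
        gcongr
        exact (A x).le_of_opNorm_le (hK x) _
    _ = (1 + ‖x‖) ^ N * ‖φ x‖ * (K * ‖x‖ ^ d) := by ring
    _ ≤ (2 ^ N * D + C) * ‖x‖ ^ m * (K * ‖x‖ ^ d) :=
        mul_le_mul_of_nonneg_right (h1 x) (hK0 x)
    _ = _ := by rw [pow_add]; ring

theorem isRapid_clm_apply_schwartz {d : ℕ} {A : Eucl n → V →L[ℂ] V} (hA : Continuous A)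
    {K : ℝ} (hK : ∀ x, ‖A x‖ ≤ K * ‖x‖ ^ d) (φ : 𝓢(Eucl n, V)) :
    IsRapid d (fun x => A x (φ x)) := by
  obtain ⟨C, hC⟩ := exists_schwartz_bound φ 0
  simpa using isRapid_clm_apply (m := 0) hA hK φ (D := C) (by simpa using hC)

/-- Integration against `‖x‖ ^ z • A x` is a tempered distribution when `Re z + d > -n`. -/
theorem exists_weightCLM [NeZero n] {d : ℕ} {A : Eucl n → V →L[ℂ] V} (hA : Continuous A)
    {K : ℝ} (hK : ∀ x, ‖A x‖ ≤ K * ‖x‖ ^ d) {z : ℂ} (hz : -(n : ℝ) < z.re + d) :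
    ∃ T : 𝓢(Eucl n, V) →L[ℂ] V, ∀ φ, T φ = ∫ x : Eucl n, (‖x‖ : ℂ) ^ z • A x (φ x) := by
  have hint (φ : 𝓢(Eucl n, V)) := (isRapid_clm_apply_schwartz hA hK φ).integrable_cpow_smul hz
  have hK0 (x : Eucl n) : 0 ≤ K * ‖x‖ ^ d := (norm_nonneg _).trans (hK x)
  obtain ⟨N, hN⟩ := exists_nat_gt (z.re + d + n)
  have hI := integrable_norm_rpow_mul_one_add_norm hz hN
  refine ⟨SchwartzMap.mkCLMtoNormedSpace (fun φ => ∫ x : Eucl n, (‖x‖ : ℂ) ^ z • A x (φ x))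
    (fun φ ψ => ?_) (fun c φ => ?_) ⟨Finset.Iic (N, 0), |∫ x : Eucl n,
      K * (‖x‖ ^ (z.re + d) * ((1 + ‖x‖) ^ N)⁻¹)| * 2 ^ N, by positivity, fun φ => ?_⟩,
    fun φ => rfl⟩
  · rw [← integral_add (hint φ) (hint ψ)]
    simp
  · rw [RingHom.id_apply, ← integral_smul]
    simp only [smul_apply, map_smul]
    exact integral_congr_ae (Eventually.of_forall fun x => smul_comm _ _ _)
  · set S := (Finset.Iic (N, 0)).sup (schwartzSeminormFamily ℂ (Eucl n) V) φ with hS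
    have hS0 : 0 ≤ S := apply_nonneg _ _
    have hb (x : Eucl n) : (1 + ‖x‖) ^ N * ‖φ x‖ ≤ 2 ^ N * S := by
      simpa using! SchwartzMap.one_add_le_sup_seminorm_apply (𝕜 := ℂ) (m := (N, 0)) (k := N)
        (n := 0) le_rfl le_rfl φ x
    calc ‖∫ x : Eucl n, (‖x‖ : ℂ) ^ z • A x (φ x)‖
        ≤ ∫ x : Eucl n, K * (‖x‖ ^ (z.re + d) * ((1 + ‖x‖) ^ N)⁻¹) * (2 ^ N * S) := by
          refine norm_integral_le_of_norm_le ((hI.const_mul K).mul_const _) ?_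
          filter_upwards [ae_ne_zero] with x hx
          have h0 : 0 < ‖x‖ := norm_pos_iff.2 hx
          have h1 : ‖φ x‖ ≤ (2 ^ N * S) * ((1 + ‖x‖) ^ N)⁻¹ := by
            rw [← div_eq_mul_inv, le_div_iff₀ (by positivity), mul_comm]
            exact hb x
          rw [norm_cpow_smul hx, Real.rpow_add h0, Real.rpow_natCast]
          calc ‖x‖ ^ z.re * ‖A x (φ x)‖
              ≤ ‖x‖ ^ z.re * ((K * ‖x‖ ^ d) * ((2 ^ N * S) * ((1 + ‖x‖) ^ N)⁻¹)) := by
                gcongr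
                exact ((A x).le_of_opNorm_le (hK x) _).trans
                  (mul_le_mul_of_nonneg_left h1 (hK0 x))
            _ = _ := by ring
      _ = (∫ x : Eucl n, K * (‖x‖ ^ (z.re + d) * ((1 + ‖x‖) ^ N)⁻¹)) * (2 ^ N * S) :=
          integral_mul_const _ _
      _ ≤ _ := by
          rw [mul_assoc]
          gcongr
          exact le_abs_self _

end Weights

/-! ### Gaussian averages and their Mellin transforms -/

section Theta

open MeasureTheory Set Filter Topology FourierTransform Real

variable {n : ℕ} {V : Type*} [NormedAddCommGroup V] [NormedSpace ℂ V]

/-- The integral of `g` against the Gaussian `exp (-π t ‖x‖²)`. -/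
def theta (g : Eucl n → V) (t : ℝ) : V := ∫ x : Eucl n, (rexp (-π * t * ‖x‖ ^ 2) : ℂ) • g x

theorem integrable_gaussian_smul {g : Eucl n → V} (hg : Integrable g) {t : ℝ} (ht : 0 ≤ t) :
    Integrable (fun x : Eucl n => (rexp (-π * t * ‖x‖ ^ 2) : ℂ) • g x) := by
  refine hg.norm.mono' ((by fun_prop : Measurable fun x : Eucl n =>
    (rexp (-π * t * ‖x‖ ^ 2) : ℂ)).aestronglyMeasurable.smul hg.1) (Eventually.of_forall fun x => ?_)
  rw [norm_smul, Complex.norm_real, Real.norm_of_nonneg (exp_nonneg _)]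
  refine mul_le_of_le_one_left (norm_nonneg _) (exp_le_one_iff.2 ?_)
  have : 0 ≤ π * t * ‖x‖ ^ 2 := by positivity
  linarith

theorem ofReal_cpow_eq_exp {r : ℝ} (hr : 0 < r) (a : ℂ) :
    (r : ℂ) ^ a = Complex.exp ((Real.log r : ℂ) * a) := by
  rw [Complex.cpow_def_of_ne_zero (by exact_mod_cast hr.ne'), Complex.ofReal_log hr.le]

theorem integrableOn_rpow_mul_exp_neg {a r : ℝ} (ha : 0 < a) (hr : 0 < r) :
    IntegrableOn (fun t : ℝ => t ^ (a - 1) * rexp (-(r * t))) (Ioi 0) := by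
  -- The integral of a non-integrable function is `0` by default, while the known value is a
  -- positive multiple of `Γ(a)`.
  by_contra h
  have h1 := Real.integral_rpow_mul_exp_neg_mul_Ioi ha hr
  rw [integral_undef h] at h1
  have := Real.Gamma_pos_of_pos ha
  exact absurd h1 (by positivity)

variable [CompleteSpace V]

/-- The Mellin transform of `theta g`. -/
theorem hasMellin_theta [NeZero n] {g : Eucl n → V} {a : ℂ} (ha : 0 < a.re)
    (hg : AEStronglyMeasurable g volume)
    (hint : Integrable (fun x => ‖x‖ ^ (-2 * a.re) * ‖g x‖)) :
    HasMellin (theta g) a (((π : ℂ) ^ (-a) * Complex.Gamma a) •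
      ∫ x : Eucl n, (‖x‖ : ℂ) ^ (-2 * a) • g x) := by
  -- Fubini for this integrand: integrating in `t` first gives a Gamma integral at each `x ≠ 0`,
  -- integrating in `x` first gives the Mellin integrand of `theta g`.
  set F : ℝ → Eucl n → V := fun t x =>
    ((t : ℂ) ^ (a - 1)) • (rexp (-π * t * ‖x‖ ^ 2) : ℂ) • g x with hF
  have hmeas : AEStronglyMeasurable (Function.uncurry F)
      ((volume.restrict (Ioi 0)).prod volume) := by
    have h1 : AEStronglyMeasurable (fun p : ℝ × Eucl n => g p.2)
        ((volume.restrict (Ioi 0)).prod volume) := hg.comp_snd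
    have h2 : Measurable fun p : ℝ × Eucl n =>
      ((p.1 : ℂ) ^ (a - 1)) * (rexp (-π * p.1 * ‖p.2‖ ^ 2) : ℂ) := by fun_prop
    have h3 := h2.aestronglyMeasurable.smul h1
    refine h3.congr (Eventually.of_forall fun p => ?_)
    simp [Function.uncurry_def, hF, mul_smul]
  have hpos (x : Eucl n) (hx : x ≠ 0) : 0 < π * ‖x‖ ^ 2 := by
    have := norm_pos_iff.2 hx
    positivity
  have hinner (x : Eucl n) (hx : x ≠ 0) : ∫ t in Ioi (0 : ℝ), F t x
      = ((π : ℂ) ^ (-a) * Complex.Gamma a) • ((‖x‖ : ℂ) ^ (-2 * a) • g x) := by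
    have h := Complex.integral_cpow_mul_exp_neg_mul_Ioi ha (hpos x hx)
    have hx0 : 0 < ‖x‖ := norm_pos_iff.2 hx
    have e : ∀ t : ℝ, F t x
        = ((t : ℂ) ^ (a - 1) * Complex.exp (-(((π * ‖x‖ ^ 2 : ℝ) : ℂ) * t))) • g x := by
      intro t
      simp only [hF, mul_smul]
      congr 2
      push_cast
      ring_nf
    simp only [e]
    rw [integral_smul_const, h, smul_smul]
    congr 1
    rw [one_div, ← Complex.ofReal_inv, ofReal_cpow_eq_exp (inv_pos.2 (hpos x hx)),
      ofReal_cpow_eq_exp pi_pos, ofReal_cpow_eq_exp hx0, Real.log_inv,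
      Real.log_mul pi_ne_zero (by positivity), Real.log_pow, mul_right_comm, ← Complex.exp_add]
    congr 2
    push_cast
    ring
  have hnorm (x : Eucl n) (t : ℝ) (ht : t ∈ Ioi (0 : ℝ)) :
      ‖F t x‖ = t ^ (a.re - 1) * rexp (-((π * ‖x‖ ^ 2) * t)) * ‖g x‖ := by
    simp only [hF]
    rw [norm_smul, norm_smul, Complex.norm_cpow_eq_rpow_re_of_pos ht, Complex.norm_real,
      Real.norm_of_nonneg (exp_nonneg _), Complex.sub_re, Complex.one_re, mul_assoc]
    ring_nf
  have hFint : Integrable (Function.uncurry F) ((volume.restrict (Ioi 0)).prod volume) := by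
    rw [integrable_prod_iff' hmeas]
    constructor
    · filter_upwards [ae_ne_zero, hmeas.prodMk_right] with x hx hxm
      refine ((integrableOn_rpow_mul_exp_neg ha (hpos x hx)).mul_const ‖g x‖).mono' hxm ?_
      filter_upwards [ae_restrict_mem measurableSet_Ioi] with t ht
      exact (hnorm x t ht).le
    · refine (hint.const_mul (π ^ (-a.re) * Real.Gamma a.re)).congr ?_
      filter_upwards [ae_ne_zero] with x hx
      have hx0 : 0 < ‖x‖ := norm_pos_iff.2 hx
      simp only [Function.uncurry]
      rw [setIntegral_congr_fun measurableSet_Ioi (hnorm x), integral_mul_const,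
        Real.integral_rpow_mul_exp_neg_mul_Ioi ha (hpos x hx), one_div, Real.inv_rpow (by positivity),
        Real.mul_rpow pi_pos.le (by positivity), ← Real.rpow_natCast ‖x‖ 2,
        ← Real.rpow_mul hx0.le, mul_inv, ← Real.rpow_neg pi_pos.le, ← Real.rpow_neg hx0.le]
      push_cast
      ring_nf
  have hth (t : ℝ) : ∫ x, F t x = (t : ℂ) ^ (a - 1) • theta g t := by
    simp only [hF, theta, integral_smul]
  constructor
  · have := hFint.integral_prod_left
    simp only [Function.uncurry, hth] at this
    exact this
  · rw [mellin]
    simp only [← hth]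
    rw [integral_integral_swap hFint, ← integral_smul]
    refine integral_congr_ae ?_
    filter_upwards [ae_ne_zero] with x hx
    exact hinner x hx

end Theta

/-! ### Behaviour of Gaussian averages under `t ↦ 1/t` -/

section ThetaTransform

open MeasureTheory Set Filter Topology FourierTransform Real LineDeriv

variable {n : ℕ} {V : Type*} [NormedAddCommGroup V] [NormedSpace ℂ V]

theorem integrable_gaussian {t : ℝ} (ht : 0 < t) :
    Integrable (fun x : Eucl n => (rexp (-π * t * ‖x‖ ^ 2) : ℂ)) := by
  have h := GaussianFourier.integrable_cexp_neg_mul_sq_norm_add (V := Eucl n) (b := (π * t : ℝ))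
    (by simpa using mul_pos pi_pos ht) 0 0
  refine h.congr (Eventually.of_forall fun x => ?_)
  simp

/-- Multiplication of a Schwartz function by a linear form. -/
abbrev mulInner (m : Eucl n) : 𝓢(Eucl n, V) →L[ℝ] 𝓢(Eucl n, V) :=
  SchwartzMap.smulLeftCLM V (fun x : Eucl n => inner ℝ x m)

theorem mulInner_apply (m : Eucl n) (φ : 𝓢(Eucl n, V)) (x : Eucl n) :
    mulInner m φ x = (inner ℝ x m) • φ x :=
  SchwartzMap.smulLeftCLM_apply_apply (((innerSL ℝ).flip m).hasTemperateGrowth) φ x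

theorem theta_add {f g : Eucl n → V} (hf : Integrable f) (hg : Integrable g) {t : ℝ} (ht : 0 ≤ t) :
    theta (fun x => f x + g x) t = theta f t + theta g t := by
  simp only [theta, smul_add]
  exact integral_add (integrable_gaussian_smul hf ht) (integrable_gaussian_smul hg ht)

theorem theta_smul (c : ℂ) (f : Eucl n → V) (t : ℝ) :
    theta (fun x => c • f x) t = c • theta f t := by
  simp only [theta, smul_comm _ c, integral_smul]

/-- Integration by parts against a Gaussian. -/
theorem theta_lineDeriv (ψ : 𝓢(Eucl n, V)) (m : Eucl n) {t : ℝ} (ht : 0 ≤ t) :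
    theta (∂_{m} ψ : 𝓢(Eucl n, V)) t = (2 * π * t : ℂ) • theta (mulInner m ψ) t := by
  have hd (x : Eucl n) : HasFDerivAt (fun x : Eucl n => (rexp (-π * t * ‖x‖ ^ 2) : ℂ))
      (Complex.ofRealCLM.comp (rexp (-π * t * ‖x‖ ^ 2) •
        ((-π * t) • (2 • (innerSL ℝ x))))) x :=
    Complex.ofRealCLM.hasFDerivAt.comp x
      (((hasStrictFDerivAt_norm_sq x).hasFDerivAt.const_mul (-π * t)).exp)
  have he (x : Eucl n) : fderiv ℝ (fun x : Eucl n => (rexp (-π * t * ‖x‖ ^ 2) : ℂ)) x m • ψ x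
      = (-(2 * π * t) : ℂ) • (rexp (-π * t * ‖x‖ ^ 2) : ℂ) • mulInner m ψ x := by
    rw [(hd x).fderiv, mulInner_apply, ← Complex.coe_smul (inner ℝ x m)]
    simp only [smul_smul]
    congr 1
    simp [innerSL_apply_apply ℝ]
    ring
  have h := integral_smul_fderiv_eq_neg_fderiv_smul_of_integrable
    (f := fun x : Eucl n => (rexp (-π * t * ‖x‖ ^ 2) : ℂ)) (g := ψ) (v := m) (μ := volume)
    (𝕜 := ℂ) ?_ ?_ ?_ (fun x _ => (hd x).differentiableAt)
    (fun x _ => ψ.differentiableAt)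
  · simp only [he, integral_smul] at h
    simp only [theta, SchwartzMap.lineDerivOp_apply_eq_fderiv]
    rw [h, neg_smul, neg_neg]
  · simp only [he]
    exact (integrable_gaussian_smul (mulInner m ψ).integrable ht).smul _
  · exact integrable_gaussian_smul (∂_{m} ψ : 𝓢(Eucl n, V)).integrable ht
  · exact integrable_gaussian_smul ψ.integrable ht

theorem mulInner_lineDeriv (ψ : 𝓢(Eucl n, V)) (a b : Eucl n) (x : Eucl n) :
    mulInner a (∂_{b} ψ) x + (inner ℝ a b : ℂ) • ψ x
      = (∂_{b} (mulInner a ψ) : 𝓢(Eucl n, V)) x := by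
  have h1 : HasFDerivAt (fun y : Eucl n => inner ℝ y a) ((innerSL ℝ).flip a) x :=
    ((innerSL ℝ).flip a).hasFDerivAt
  have h : HasFDerivAt (mulInner a ψ) _ x :=
    (h1.smul (ψ.hasFDerivAt x)).congr_of_eventuallyEq
      (Eventually.of_forall fun y => mulInner_apply a ψ y)
  rw [SchwartzMap.lineDerivOp_apply_eq_fderiv, h.fderiv, mulInner_apply,
    SchwartzMap.lineDerivOp_apply_eq_fderiv]
  simp [innerSL_apply_apply ℝ]

/-- Two integrations by parts; the inner product term is the commutator of `∂_b` with multiplication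
by `⟨·, a⟩`. -/
theorem theta_lineDeriv_lineDeriv (ψ : 𝓢(Eucl n, V)) (a b : Eucl n) {t : ℝ} (ht : 0 ≤ t) :
    theta (∂_{a} (∂_{b} ψ) : 𝓢(Eucl n, V)) t = (2 * π * t : ℂ) •
      ((2 * π * t : ℂ) • theta (mulInner b (mulInner a ψ)) t - (inner ℝ a b : ℂ) • theta ψ t) := by
  have key : theta (mulInner a (∂_{b} ψ)) t + (inner ℝ a b : ℂ) • theta ψ t
      = theta (∂_{b} (mulInner a ψ) : 𝓢(Eucl n, V)) t := by
    rw [← theta_smul, ← theta_add (SchwartzMap.integrable _)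
      (g := fun x => (inner ℝ a b : ℂ) • ψ x) (ψ.integrable.smul _) ht]
    congr 1
    exact funext fun x => mulInner_lineDeriv ψ a b x
  rw [theta_lineDeriv _ _ ht, ← theta_lineDeriv (mulInner a ψ) b ht, ← key, add_sub_cancel_right]

variable [CompleteSpace V]

/-- Parseval's formula for a Gaussian. -/
theorem theta_eq_theta_fourier (φ : 𝓢(Eucl n, V)) {t : ℝ} (ht : 0 < t) :
    theta φ t = ((t : ℂ) ^ (-(n : ℂ) / 2)) • theta (𝓕 φ : 𝓢(Eucl n, V)) t⁻¹ := by
  have h := VectorFourier.integral_fourierIntegral_smul_eq_flip (L := innerₗ (Eucl n))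
    (μ := volume) (ν := volume) continuous_fourierChar continuous_inner
    (integrable_gaussian (n := n) (inv_pos.2 ht)) φ.integrable
  have hG (w : Eucl n) : VectorFourier.fourierIntegral 𝐞 volume (innerₗ (Eucl n))
      (fun x : Eucl n => (rexp (-π * t⁻¹ * ‖x‖ ^ 2) : ℂ)) w
      = (t : ℂ) ^ ((n : ℂ) / 2) * (rexp (-π * t * ‖w‖ ^ 2) : ℂ) := by
    have h2 := fourier_gaussian_innerProductSpace (V := Eucl n) (b := (π * t⁻¹ : ℝ))
      (by simpa using mul_pos pi_pos (inv_pos.2 ht)) w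
    have hp : (π : ℂ) ≠ 0 := by exact_mod_cast pi_ne_zero
    have ht' : (t : ℂ) ≠ 0 := by exact_mod_cast ht.ne'
    rw [finrank_euclideanSpace, Fintype.card_fin] at h2
    convert! h2 using 1
    · congr 1
      ext v
      push_cast
      ring_nf
    · push_cast
      congr 2
      · field_simp
      · field_simp
  simp only [hG, mul_smul, integral_smul] at h
  have h3 : (t : ℂ) ^ ((n : ℂ) / 2) • theta φ t = theta (𝓕 φ : 𝓢(Eucl n, V)) t⁻¹ := by
    rw [theta, h, theta]
    refine integral_congr_ae (Eventually.of_forall fun x => ?_)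
    simp [SchwartzMap.fourier_coe, Real.fourier_eq]
    rfl
  rw [← h3, smul_smul, neg_div, ← Complex.cpow_add _ _ (by exact_mod_cast ht.ne')]
  simp

omit [CompleteSpace V] in
theorem fourier_mulInner (φ : 𝓢(Eucl n, V)) (a : Eucl n) :
    𝓕 (mulInner a φ) = (-(2 * π * Complex.I))⁻¹ • (∂_{a} (𝓕 φ) : 𝓢(Eucl n, V)) := by
  have h : (-(2 * π * Complex.I)) ≠ 0 := by simp [pi_ne_zero]
  rw [SchwartzMap.lineDerivOp_fourier_eq, FourierTransform.fourier_smul, smul_smul,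
    inv_mul_cancel₀ h, one_smul]

/-- The Fourier transform turns the two linear factors into derivatives, and integration by parts
against the dual Gaussian turns these back into linear factors, at the price of the `⟨a, b⟩` term.
-/
theorem theta_mulInner_mulInner (φ : 𝓢(Eucl n, V)) (a b : Eucl n) {t : ℝ} (ht : 0 < t) :
    theta (mulInner a (mulInner b φ)) t = ((t : ℂ) ^ (-(n : ℂ) / 2)) •
      ((((t⁻¹ : ℝ) : ℂ) / (2 * π)) • (inner ℝ a b : ℂ) • theta (𝓕 φ : 𝓢(Eucl n, V)) t⁻¹ -
        ((t⁻¹ : ℝ) : ℂ) ^ 2 • theta (mulInner a (mulInner b (𝓕 φ))) t⁻¹) := by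
  have h1 : 𝓕 (mulInner a (mulInner b φ))
      = (-(4 * π ^ 2 : ℂ)⁻¹) • (∂_{a} (∂_{b} (𝓕 φ)) : 𝓢(Eucl n, V)) := by
    rw [fourier_mulInner, fourier_mulInner, lineDerivOp_smul, smul_smul]
    congr 1
    rw [← mul_inv, ← inv_neg]
    congr 1
    linear_combination (4 * π ^ 2 : ℂ) * Complex.I_sq
  have h2 : theta (mulInner b (mulInner a (𝓕 φ))) t⁻¹
      = theta (mulInner a (mulInner b (𝓕 φ))) t⁻¹ := by
    congr 1
    ext x
    simp only [mulInner_apply]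
    exact smul_comm _ _ _
  have h3 : theta (𝓕 (mulInner a (mulInner b φ)) : 𝓢(Eucl n, V)) t⁻¹
      = (-(4 * π ^ 2 : ℂ)⁻¹) • theta (∂_{a} (∂_{b} (𝓕 φ)) : 𝓢(Eucl n, V)) t⁻¹ := by
    rw [← theta_smul, h1]
    rfl
  have hp : (π : ℂ) ≠ 0 := by exact_mod_cast pi_ne_zero
  rw [theta_eq_theta_fourier _ ht, h3, theta_lineDeriv_lineDeriv _ _ _ (inv_pos.2 ht).le, h2]
  simp only [smul_sub, smul_smul]
  rw [sub_eq_add_neg, sub_eq_add_neg, add_comm, ← neg_smul, ← neg_smul]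
  generalize (t : ℂ) ^ (-(n : ℂ) / 2) = c
  generalize ((t⁻¹ : ℝ) : ℂ) = r
  congr 2
  · field_simp
    ring
  · field_simp
    ring

omit [CompleteSpace V] in
theorem quadMap_apply_schwartz (L : Fin n → Fin n → V →L[ℂ] V) (φ : 𝓢(Eucl n, V)) (x : Eucl n) :
    quadMap L x (φ x) = ∑ i, ∑ j, L i j (mulInner (EuclideanSpace.single i (1 : ℝ))
      (mulInner (EuclideanSpace.single j (1 : ℝ)) φ) x) := by
  simp only [quadMap, sum_apply, smul_apply, mulInner_apply]
  refine Finset.sum_congr rfl fun i _ => Finset.sum_congr rfl fun j _ => ?_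
  rw [← Complex.coe_smul, ← Complex.coe_smul, map_smul, map_smul, smul_smul]
  simp [EuclideanSpace.inner_single_right]

theorem theta_quadMap_eq_sum (L : Fin n → Fin n → V →L[ℂ] V) (φ : 𝓢(Eucl n, V)) {t : ℝ}
    (ht : 0 ≤ t) : theta (fun x => quadMap L x (φ x)) t
      = ∑ i, ∑ j, L i j (theta (mulInner (EuclideanSpace.single i (1 : ℝ))
        (mulInner (EuclideanSpace.single j (1 : ℝ)) φ)) t) := by
  have hI (i j : Fin n) := integrable_gaussian_smul (mulInner (EuclideanSpace.single i (1 : ℝ))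
        (mulInner (EuclideanSpace.single j (1 : ℝ)) φ)).integrable ht
  simp only [theta, quadMap_apply_schwartz, Finset.smul_sum, ← map_smul]
  rw [integral_finsetSum _ fun i _ => integrable_finsetSum _ fun j _ => (L i j).integrable_comp (hI i j)]
  refine Finset.sum_congr rfl fun i _ => ?_
  rw [integral_finsetSum _ fun j _ => (L i j).integrable_comp (hI i j)]
  exact Finset.sum_congr rfl fun j _ => (L i j).integral_comp_comm (hI i j)

/-- The theta transformation formula for a quadratic weight. -/
theorem theta_quadMap {L : Fin n → Fin n → V →L[ℂ] V} {τ : ℂ}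
    (hL : ∑ i, L i i = τ • ContinuousLinearMap.id ℂ V) (φ : 𝓢(Eucl n, V)) {t : ℝ} (ht : 0 < t) :
    theta (fun x => quadMap L x (φ x)) t = ((t : ℂ) ^ (-(n : ℂ) / 2)) •
      ((((t⁻¹ : ℝ) : ℂ) / (2 * π)) • τ • theta (𝓕 φ : 𝓢(Eucl n, V)) t⁻¹ -
        ((t⁻¹ : ℝ) : ℂ) ^ 2 • theta (fun x => quadMap L x ((𝓕 φ : 𝓢(Eucl n, V)) x)) t⁻¹) := by
  -- The `⟨e_i, e_j⟩` corrections contract `L` to its diagonal sum, which is where `τ` enters the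
  -- formula.
  have hτ (v : V) : τ • v = ∑ i, ∑ j,
      (inner ℝ (EuclideanSpace.single i (1 : ℝ)) (EuclideanSpace.single j (1 : ℝ)) : ℂ)
        • L i j v := by
    have := congrArg (fun A : V →L[ℂ] V => A v) hL
    simp only [sum_apply, smul_apply, ContinuousLinearMap.id_apply] at this
    rw [← this]
    refine Finset.sum_congr rfl fun i _ => ?_
    rw [Finset.sum_eq_single i] <;>
      simp +contextual [EuclideanSpace.inner_single_left, eq_comm]
  rw [theta_quadMap_eq_sum L φ ht.le, theta_quadMap_eq_sum L _ (inv_pos.2 ht).le, hτ]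
  simp only [theta_mulInner_mulInner _ _ _ ht, map_smul, map_sub, Finset.smul_sum, smul_sub,
    ← Finset.sum_sub_distrib]

end ThetaTransform

/-! ### Fourier transform of the homogeneous kernel -/

section FunctionalEquation

open MeasureTheory Set Filter Topology FourierTransform Real

variable {n : ℕ} {V : Type*} [NormedAddCommGroup V] [NormedSpace ℂ V]

theorem continuous_quadMap (L : Fin n → Fin n → V →L[ℂ] V) : Continuous (quadMap L) := by
  unfold quadMap
  fun_prop

theorem norm_quadMap_le (L : Fin n → Fin n → V →L[ℂ] V) (x : Eucl n) :
    ‖quadMap L x‖ ≤ (∑ i, ∑ j, ‖L i j‖) * ‖x‖ ^ 2 := by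
  unfold quadMap
  rw [Finset.sum_mul]
  refine norm_sum_le_of_le _ fun i _ => ?_
  rw [Finset.sum_mul]
  refine norm_sum_le_of_le _ fun j _ => ?_
  rw [norm_smul, norm_mul, Complex.norm_real, Complex.norm_real, mul_comm, sq]
  gcongr
  · exact PiLp.norm_apply_le x i
  · exact PiLp.norm_apply_le x j

/-- The symbol of the Fourier transform of `‖x‖ ^ (s - 2) • quadMap L x`, up to a scalar and
the factor `‖ξ‖ ^ (-n - s - 2)`. -/
def fourierSymbol (L : Fin n → Fin n → V →L[ℂ] V) (τ s : ℂ) (ξ : Eucl n) : V →L[ℂ] V :=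
  (τ * (‖ξ‖ : ℂ) ^ 2) • ContinuousLinearMap.id ℂ V - (n + s) • quadMap L ξ

theorem fourierSymbol_apply (L : Fin n → Fin n → V →L[ℂ] V) (τ s : ℂ) (ξ : Eucl n) (v : V) :
    fourierSymbol L τ s ξ v = (τ * (‖ξ‖ : ℂ) ^ 2) • v - (n + s) • quadMap L ξ v := rfl

theorem continuous_fourierSymbol (L : Fin n → Fin n → V →L[ℂ] V) (τ s : ℂ) :
    Continuous (fourierSymbol L τ s) := by
  have := continuous_quadMap L
  unfold fourierSymbol
  fun_prop

theorem norm_fourierSymbol_le (L : Fin n → Fin n → V →L[ℂ] V) (τ s : ℂ) (ξ : Eucl n) :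
    ‖fourierSymbol L τ s ξ‖ ≤ (‖τ‖ + ‖n + s‖ * ∑ i, ∑ j, ‖L i j‖) * ‖ξ‖ ^ 2 := by
  unfold fourierSymbol
  refine (norm_sub_le _ _).trans ?_
  rw [norm_smul, norm_smul, norm_mul, norm_pow, Complex.norm_real, norm_norm, add_mul, mul_assoc,
    mul_assoc]
  gcongr
  · exact mul_le_of_le_one_right (by positivity) ContinuousLinearMap.norm_id_le
  · exact norm_quadMap_le L ξ

variable [CompleteSpace V]

omit [CompleteSpace V] in
theorem isRapid_schwartz (φ : 𝓢(Eucl n, V)) : IsRapid 0 φ :=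
  isRapid_clm_apply_schwartz (A := fun _ => ContinuousLinearMap.id ℂ V) continuous_const
    (K := 1) (by simpa using ContinuousLinearMap.norm_id_le) φ

/-- Mellin transform of `theta_quadMap`: inversion `t ↦ 1/t` reflects the Mellin variable, and each
power of `t` shifts it. The bounds on `b` make both frequency integrals converge at the origin. -/
theorem mellin_theta_quadMap [NeZero n] {L : Fin n → Fin n → V →L[ℂ] V} {τ : ℂ}
    (hL : ∑ i, L i i = τ • ContinuousLinearMap.id ℂ V) (φ : 𝓢(Eucl n, V)) {b : ℂ}
    (hb0 : 0 < b.re) (hbn : b.re < n / 2) :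
    mellin (theta fun x => quadMap L x (φ x)) (n / 2 + 1 - b)
      = (τ / (2 * π)) • mellin (theta (𝓕 φ : 𝓢(Eucl n, V))) b
        - mellin (theta fun x => quadMap L x ((𝓕 φ : 𝓢(Eucl n, V)) x)) (b + 1) := by
  have h1 := (hasMellin_theta hb0 (isRapid_schwartz (𝓕 φ)).aestronglyMeasurable
    ((isRapid_schwartz (𝓕 φ)).integrable_rpow_mul (by push_cast; linarith))).1
  have hr := isRapid_clm_apply_schwartz (continuous_quadMap L) (norm_quadMap_le L) (𝓕 φ)
  have h2 := (hasMellin_theta (a := b + 1) (by simp; linarith) hr.aestronglyMeasurable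
    (hr.integrable_rpow_mul (by simp; linarith))).1
  set f1 := theta (𝓕 φ : 𝓢(Eucl n, V))
  set f2 := theta fun x => quadMap L x ((𝓕 φ : 𝓢(Eucl n, V)) x)
  have h1' : MellinConvergent (fun u : ℝ => (u : ℂ) ^ (1 : ℂ) • (τ / (2 * π)) • f1 u) (b - 1) := by
    rw [MellinConvergent.cpow_smul, sub_add_cancel]
    exact h1.const_smul _
  have h2' : MellinConvergent (fun u : ℝ => (u : ℂ) ^ (2 : ℂ) • f2 u) (b - 1) := by
    rw [MellinConvergent.cpow_smul]
    convert h2 using 1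
    ring
  set H : ℝ → V := fun u => (u : ℂ) ^ (1 : ℂ) • (τ / (2 * π)) • f1 u - (u : ℂ) ^ (2 : ℂ) • f2 u
    with hH
  have h3 : mellin (theta fun x => quadMap L x (φ x)) (n / 2 + 1 - b)
      = mellin (fun t : ℝ => (t : ℂ) ^ (-(n : ℂ) / 2) • H t⁻¹) (n / 2 + 1 - b) := by
    refine setIntegral_congr_fun measurableSet_Ioi fun t ht => ?_
    simp only [hH]
    rw [theta_quadMap hL φ ht, Complex.cpow_one, Complex.cpow_ofNat,
      smul_smul (((t⁻¹ : ℝ) : ℂ) / (2 * π)), smul_smul ((t⁻¹ : ℝ) : ℂ), div_mul_eq_mul_div,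
      mul_div_assoc]
  rw [h3, mellin_cpow_smul, mellin_comp_inv, show -((n : ℂ) / 2 + 1 - b + -(n : ℂ) / 2) = b - 1 by
    ring, (hasMellin_sub h1' h2').2, mellin_cpow_smul, mellin_cpow_smul, mellin_const_smul]
  ring_nf

/-- The functional equation relating a homogeneous kernel and its Fourier transform, in the strip
where both are locally integrable. -/
theorem functional_equation [NeZero n] {L : Fin n → Fin n → V →L[ℂ] V} {τ : ℂ}
    (hL : ∑ i, L i i = τ • ContinuousLinearMap.id ℂ V) (φ : 𝓢(Eucl n, V)) {s : ℂ}
    (hs : -(n : ℝ) < s.re) (hs' : s.re < 0) :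
    Complex.Gamma (-s / 2 + 1) • ∫ x : Eucl n, (‖x‖ : ℂ) ^ (s - 2) • quadMap L x (φ x)
      = (1 / 2 * (π : ℂ) ^ (-(n : ℂ) / 2 - s) * Complex.Gamma ((s + n) / 2)) •
        ∫ ξ : Eucl n, (‖ξ‖ : ℂ) ^ (-n - s - 2) •
          fourierSymbol L τ s ξ ((𝓕 φ : 𝓢(Eucl n, V)) ξ) := by
  have hp : (π : ℂ) ≠ 0 := by exact_mod_cast pi_ne_zero
  -- With this `b` the spatial exponent `-2(n/2 + 1 - b)` is `s - 2` and `-2(b + 1)` is `-n - s -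
  -- 2`; the strip `0 < Re b < n/2` is `-n < Re s < 0`.
  set b : ℂ := (s + n) / 2 with hb
  have hbre : b.re = (s.re + n) / 2 := by
    rw [hb, show (2 : ℂ) = ((2 : ℝ) : ℂ) by norm_num, Complex.div_ofReal_re]; simp
  have hb0 : 0 < b.re := by rw [hbre]; linarith
  have hb1 : b ≠ 0 := fun h => by simp [h] at hb0
  have ha : (n : ℂ) / 2 + 1 - b = -s / 2 + 1 := by rw [hb]; ring
  have hare : ((n : ℂ) / 2 + 1 - b).re = -s.re / 2 + 1 := by
    rw [ha, show (2 : ℂ) = ((2 : ℝ) : ℂ) by norm_num, Complex.add_re, Complex.div_ofReal_re]; simp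
  have h := mellin_theta_quadMap hL φ (b := b) hb0 (by rw [hbre]; linarith)
  have hr0 := isRapid_schwartz (𝓕 φ)
  have hr1 := isRapid_clm_apply_schwartz (continuous_quadMap L) (norm_quadMap_le L) φ
  have hr2 := isRapid_clm_apply_schwartz (continuous_quadMap L) (norm_quadMap_le L) (𝓕 φ)
  rw [(hasMellin_theta (a := n / 2 + 1 - b) (by rw [hare]; linarith) hr1.aestronglyMeasurable
      (hr1.integrable_rpow_mul (by rw [hare]; push_cast; linarith))).2,
    (hasMellin_theta hb0 hr0.aestronglyMeasurable
      (hr0.integrable_rpow_mul (by rw [hbre]; push_cast; linarith))).2,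
    (hasMellin_theta (a := b + 1) (by simp; linarith) hr2.aestronglyMeasurable
      (hr2.integrable_rpow_mul (by rw [Complex.add_re, hbre]; simp; linarith))).2, ha] at h
  have hN : ∫ ξ : Eucl n, (‖ξ‖ : ℂ) ^ (-n - s - 2) •
          fourierSymbol L τ s ξ ((𝓕 φ : 𝓢(Eucl n, V)) ξ)
      = τ • (∫ ξ : Eucl n, (‖ξ‖ : ℂ) ^ (-2 * b) • (𝓕 φ : 𝓢(Eucl n, V)) ξ)
        - (n + s) • ∫ ξ : Eucl n, (‖ξ‖ : ℂ) ^ (-2 * (b + 1)) •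
          quadMap L ξ ((𝓕 φ : 𝓢(Eucl n, V)) ξ) := by
    rw [← integral_smul, ← integral_smul, ← integral_sub]
    · refine integral_congr_ae ?_
      filter_upwards [ae_ne_zero] with ξ hξ
      have h0 : (‖ξ‖ : ℂ) ≠ 0 := by simpa using hξ
      rw [fourierSymbol_apply, smul_sub, smul_smul, smul_smul, smul_smul, smul_smul]
      have e1 : (-n - s - 2 : ℂ) = -2 * (b + 1) := by rw [hb]; ring
      have e2 : (‖ξ‖ : ℂ) ^ (-2 * b) = (‖ξ‖ : ℂ) ^ (-n - s - 2 : ℂ) * (‖ξ‖ : ℂ) ^ 2 := by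
        rw [← Complex.cpow_ofNat (‖ξ‖ : ℂ) 2, ← Complex.cpow_add _ _ h0]
        congr 1
        rw [hb]; ring
      rw [e2, e1]
      congr 2
      · ring
      · ring
    · exact (hr0.integrable_cpow_smul (by simp [hbre]; linarith)).smul τ
    · exact (hr2.integrable_cpow_smul (by simp [hbre]; linarith)).smul (n + s : ℂ)
  rw [show (s - 2 : ℂ) = -2 * (-s / 2 + 1) by ring, hN]
  set A := ∫ x : Eucl n, (‖x‖ : ℂ) ^ (-2 * (-s / 2 + 1)) • quadMap L x (φ x)
  set B := ∫ ξ : Eucl n, (‖ξ‖ : ℂ) ^ (-2 * b) • (𝓕 φ : 𝓢(Eucl n, V)) ξ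
  set C := ∫ ξ : Eucl n, (‖ξ‖ : ℂ) ^ (-2 * (b + 1)) • quadMap L ξ ((𝓕 φ : 𝓢(Eucl n, V)) ξ)
  have h4 : Complex.Gamma (-s / 2 + 1) • A = (π : ℂ) ^ (-s / 2 + 1) •
      ((π : ℂ) ^ (-(-s / 2 + 1)) * Complex.Gamma (-s / 2 + 1)) • A := by
    rw [smul_smul, ← mul_assoc, ← Complex.cpow_add _ _ hp, add_neg_cancel, Complex.cpow_zero,
      one_mul]
  have e3 : (π : ℂ) ^ (-s / 2 + 1) * (π : ℂ) ^ (-b) = π * (π : ℂ) ^ (-(n : ℂ) / 2 - s) := by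
    have h5 : (π : ℂ) * (π : ℂ) ^ (-(n : ℂ) / 2 - s) = (π : ℂ) ^ (1 + (-(n : ℂ) / 2 - s)) := by
      rw [Complex.cpow_add _ _ hp, Complex.cpow_one]
    rw [← Complex.cpow_add _ _ hp, h5]
    congr 1
    rw [hb]; ring
  have e4 : (π : ℂ) ^ (-s / 2 + 1) * (π : ℂ) ^ (-(b + 1)) = (π : ℂ) ^ (-(n : ℂ) / 2 - s) := by
    rw [← Complex.cpow_add _ _ hp]
    congr 1
    rw [hb]; ring
  -- `Γ(b + 1) = b Γ(b)` with `2b = n + s` produces the coefficient `n + s` of `fourierSymbol` and a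
  -- common factor `Γ(b)`.
  rw [h4, h, Complex.Gamma_add_one b hb1]
  simp only [smul_sub, smul_smul]
  congr 2
  · rw [show (π : ℂ) ^ (-s / 2 + 1) * (τ / (2 * π) * ((π : ℂ) ^ (-b) * Complex.Gamma b))
      = ((π : ℂ) ^ (-s / 2 + 1) * (π : ℂ) ^ (-b)) * (τ / (2 * π) * Complex.Gamma b) by ring, e3]
    field_simp
  · rw [← mul_assoc, e4, show (n + s : ℂ) = 2 * b by rw [hb]; ring]
    ring

end FunctionalEquation

/-! ### Meromorphic continuation of the Riesz family -/

section RieszFamily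

open MeasureTheory Set Filter Topology FourierTransform

variable {n k : ℕ}

/-- The trace coefficient `n - 2k` of the symbol. -/
abbrev symbolTrace (n k : ℕ) : ℂ := n - 2 * k

/-- The integral of a form against the kernel `‖x‖ ^ (s - 2) (ι_x ε_x - ε_x ι_x)`. -/
def positionIntegral (n k : ℕ) (s : ℂ) (ω : SchwartzForm n k) : AltForm n k :=
  ∫ x : Eucl n, (‖x‖ : ℂ) ^ (s - 2) • symbol n k x (ω x)

/-- The integral of the Fourier transform of a form against the Fourier transform of the
Riesz kernel, up to a scalar. -/
def frequencyIntegral (n k : ℕ) (s : ℂ) (ω : SchwartzForm n k) : AltForm n k :=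
  ∫ ξ : Eucl n, (‖ξ‖ : ℂ) ^ (-n - s - 2) •
    fourierSymbol (symbolCoeff n k) (symbolTrace n k) s ξ ((𝓕 ω : SchwartzForm n k) ξ)

/-- The scalar factor on the frequency side. -/
def frequencyFactor (n : ℕ) (s : ℂ) : ℂ :=
  (Real.pi : ℂ) ^ (-(n : ℂ) / 2) * 2 ^ (-s - n + 1) * (1 / 2 * (Real.pi : ℂ) ^ (-(n : ℂ) / 2 - s))

theorem frequencyFactor_ne_zero (n : ℕ) (s : ℂ) : frequencyFactor n s ≠ 0 := by
  simp [frequencyFactor, Complex.cpow_eq_zero_iff, Real.pi_ne_zero]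

theorem rieszIntegral_eq (s : ℂ) (ω : SchwartzForm n k) :
    rieszIntegral n k s ω = rieszFactor n s • positionIntegral n k s ω := by
  simp only [rieszIntegral, positionIntegral, symbol_apply]

theorem half_re (z : ℂ) : (z / 2).re = z.re / 2 := by
  rw [show (2 : ℂ) = ((2 : ℝ) : ℂ) by norm_num, Complex.div_ofReal_re]

theorem Gamma_ne_zero_of_neg_lt_re {s : ℂ} (hs : -(n : ℝ) < s.re) :
    Complex.Gamma ((s + n) / 2) ≠ 0 :=
  Complex.Gamma_ne_zero_of_re_pos (by rw [half_re]; simp; linarith)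

theorem ne_neg_natCast_of_notMem_rieszPoles {s : ℂ} (hs : s ∉ rieszPoles) (m : ℕ) :
    -s / 2 + 1 ≠ -m := fun h => hs ⟨m, by linear_combination -2 * h⟩

theorem Gamma_ne_zero_of_notMem_rieszPoles {s : ℂ} (hs : s ∉ rieszPoles) :
    Complex.Gamma (-s / 2 + 1) ≠ 0 :=
  Complex.Gamma_ne_zero (ne_neg_natCast_of_notMem_rieszPoles hs)

theorem differentiable_one_div_Gamma_comp {f : ℂ → ℂ} (hf : Differentiable ℂ f) :
    Differentiable ℂ fun z => (Complex.Gamma (f z))⁻¹ :=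
  Complex.differentiable_one_div_Gamma.comp hf

theorem differentiable_rieszConst (n : ℕ) :
    Differentiable ℂ fun s : ℂ => (Real.pi : ℂ) ^ (-(n : ℂ) / 2) * 2 ^ (-s - n + 1) := by
  intro s
  refine DifferentiableAt.const_mul (DifferentiableAt.const_cpow (by fun_prop) (Or.inl two_ne_zero)) _

theorem differentiable_frequencyFactor (n : ℕ) : Differentiable ℂ (frequencyFactor n) := by
  intro s
  refine (differentiable_rieszConst n s).mul (DifferentiableAt.const_mul
    (DifferentiableAt.const_cpow (by fun_prop) (Or.inl ?_)) _)
  exact_mod_cast Real.pi_ne_zero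

theorem differentiableAt_rieszFactor {s : ℂ} (hs : s ∉ rieszPoles) :
    DifferentiableAt ℂ (rieszFactor n) s := by
  refine (differentiable_rieszConst n s).mul ?_
  simp only [div_eq_mul_inv (Complex.Gamma _)]
  refine DifferentiableAt.mul ?_ (differentiable_one_div_Gamma_comp (by fun_prop) s)
  exact DifferentiableAt.comp (f := fun z : ℂ => -z / 2 + 1) s
    (Complex.differentiableAt_Gamma _ (ne_neg_natCast_of_notMem_rieszPoles hs)) (by fun_prop)

theorem meromorphicAt_rieszFactor (s : ℂ) : MeromorphicAt (rieszFactor n) s := by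
  refine MeromorphicAt.mul ((differentiable_rieszConst n).analyticAt s).meromorphicAt ?_
  have h1 : MeromorphicAt (fun z : ℂ => (Complex.Gamma (-z / 2 + 1))⁻¹) s :=
    ((differentiable_one_div_Gamma_comp (by fun_prop)).analyticAt s).meromorphicAt
  have h2 : MeromorphicAt (fun z : ℂ => (Complex.Gamma ((z + n) / 2))⁻¹) s :=
    ((differentiable_one_div_Gamma_comp (by fun_prop)).analyticAt s).meromorphicAt
  refine (h1.inv.mul h2).congr (Eventually.of_forall fun z => ?_)
  simp [div_eq_mul_inv]

theorem countable_rieszPoles : rieszPoles.Countable := by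
  have : rieszPoles = range fun m : ℕ => 2 * ((m : ℂ) + 1) := by
    ext s; simp [rieszPoles, eq_comm]
  rw [this]
  exact countable_range _

theorem isClosed_rieszPoles : IsClosed rieszPoles := by
  -- At its poles `Complex.Gamma` takes the default value `0`, and `0⁻¹ = 0` is the correct value of
  -- the entire function `1/Γ`.
  have h : rieszPoles = {s : ℂ | (Complex.Gamma (-s / 2 + 1))⁻¹ = 0} := by
    ext s
    simp only [rieszPoles, mem_ofPred_eq, inv_eq_zero, Complex.Gamma_eq_zero_iff]
    exact exists_congr fun m => ⟨fun h => by rw [h]; ring, fun h => by linear_combination -2 * h⟩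
  rw [h]
  exact isClosed_eq (differentiable_one_div_Gamma_comp (by fun_prop)).continuous continuous_const

theorem eventually_nhdsWithin_notMem_rieszPoles (s : ℂ) : ∀ᶠ z in 𝓝[≠] s, z ∉ rieszPoles := by
  have h := (differentiable_one_div_Gamma_comp (f := fun s : ℂ => -s / 2 + 1)
    (by fun_prop)).differentiableOn.analyticOnNhd isOpen_univ
  rcases (h s (mem_univ s)).eventually_eq_zero_or_eventually_ne_zero with h0 | h0
  · have := h.eqOn_zero_of_preconnected_of_eventuallyEq_zero isPreconnected_univ (mem_univ s) h0
      (mem_univ 0)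
    simp at this
  · filter_upwards [h0] with z hz
    rintro ⟨m, rfl⟩
    refine hz (inv_eq_zero.2 ((Complex.Gamma_eq_zero_iff _).2 ⟨m, by ring⟩))

theorem notMem_rieszPoles_of_re_neg {z : ℂ} (hz : z.re < 0) : z ∉ rieszPoles := by
  rintro ⟨m, rfl⟩
  simp at hz
  linarith [(Nat.cast_nonneg m : (0 : ℝ) ≤ m)]

theorem strip_mem_nhds (hn : 1 ≤ n) :
    {z : ℂ | -(n : ℝ) < z.re ∧ z.re < 0} ∈ 𝓝 (-1 / 2 : ℂ) := by
  have hn' : (1 : ℝ) ≤ n := by exact_mod_cast hn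
  refine (isOpen_Ioo.preimage Complex.continuous_re).mem_nhds ?_
  simp only [mem_preimage, half_re, mem_Ioo]
  constructor <;> norm_num
  linarith

variable [NeZero n]

theorem differentiableAt_positionIntegral (ω : SchwartzForm n k) {s : ℂ} (hs : -(n : ℝ) < s.re) :
    DifferentiableAt ℂ (fun z => positionIntegral n k z ω) s := by
  have h := (isRapid_clm_apply_schwartz (continuous_quadMap (symbolCoeff n k))
    (norm_quadMap_le _) ω).differentiableAt_integral (z₀ := s - 2) (by simpa using hs)
  exact h.comp (f := fun z : ℂ => z - 2) s (by fun_prop)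

theorem differentiableAt_frequencyIntegral (ω : SchwartzForm n k) {m : ℕ} {D : ℝ}
    (hD : ∀ ξ, ‖(𝓕 ω : SchwartzForm n k) ξ‖ ≤ D * ‖ξ‖ ^ m) {s : ℂ} (hs : s.re < m) :
    DifferentiableAt ℂ (fun z => frequencyIntegral n k z ω) s := by
  set L := symbolCoeff n k
  set τ := symbolTrace n k
  -- At parameter `-n` the `quadMap` term vanishes. Thus the symbol splits into two `z`-independent
  -- symbols with coefficients `1` and `-(n + z)`, and holomorphy follows term by term.
  have hr0 := isRapid_clm_apply (continuous_fourierSymbol L τ (-n)) (norm_fourierSymbol_le L τ (-n))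
    (𝓕 ω) hD
  have hr1 := isRapid_clm_apply (continuous_quadMap L) (norm_quadMap_le L) (𝓕 ω) hD
  have hz (z : ℂ) (hz : z.re < m) : -(n : ℝ) < (-n - z - 2 : ℂ).re + ((m + 2 : ℕ) : ℝ) := by
    simp; linarith
  have hd0 := (hr0.differentiableAt_integral (hz s hs)).comp (f := fun z : ℂ => -n - z - 2) s
    (by fun_prop)
  have hd1 := (hr1.differentiableAt_integral (hz s hs)).comp (f := fun z : ℂ => -n - z - 2) s
    (by fun_prop)
  have hd : DifferentiableAt ℂ (fun z : ℂ =>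
      (∫ ξ : Eucl n, (‖ξ‖ : ℂ) ^ (-n - z - 2) • fourierSymbol L τ (-n) ξ
        ((𝓕 ω : SchwartzForm n k) ξ)) - (n + z) • ∫ ξ : Eucl n, (‖ξ‖ : ℂ) ^ (-n - z - 2) •
        quadMap L ξ ((𝓕 ω : SchwartzForm n k) ξ)) s :=
    hd0.sub (DifferentiableAt.smul (((differentiableAt_id (𝕜 := ℂ) (x := s)).const_add (n : ℂ))) hd1)
  refine hd.congr_of_eventuallyEq ?_
  have hopen : {z : ℂ | z.re < m} ∈ 𝓝 s := (isOpen_lt Complex.continuous_re continuous_const).mem_nhds hs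
  filter_upwards [hopen] with z hzm
  rw [frequencyIntegral, ← integral_smul, ← integral_sub]
  · refine integral_congr_ae (Eventually.of_forall fun ξ => ?_)
    simp only [fourierSymbol_apply, smul_sub]
    rw [add_neg_cancel, zero_smul, smul_zero, sub_zero, smul_comm (n + z : ℂ)]
  · exact hr0.integrable_cpow_smul (hz z hzm)
  · exact (hr1.integrable_cpow_smul (hz z hzm)).smul (n + z : ℂ)

theorem rieszFactor_smul_positionIntegral_of_strip (ω : SchwartzForm n k) {s : ℂ}
    (hs : -(n : ℝ) < s.re) (hs' : s.re < 0) :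
    rieszFactor n s • positionIntegral n k s ω
      = frequencyFactor n s • frequencyIntegral n k s ω := by
  have h := functional_equation (L := symbolCoeff n k) (τ := symbolTrace n k)
    (sum_symbolCoeff_self n k) ω hs hs'
  have hG := Gamma_ne_zero_of_neg_lt_re hs
  change Complex.Gamma (-s / 2 + 1) • positionIntegral n k s ω
    = _ • frequencyIntegral n k s ω at h
  rw [rieszFactor, div_eq_mul_inv (Complex.Gamma _), mul_comm (Complex.Gamma _), ← mul_assoc, mul_smul, h, smul_smul,
    frequencyFactor]
  congr 1
  field_simp

/-- On forms whose Fourier transform vanishes to order `m` at the origin, the frequency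
representation of the Riesz distribution holds for `-n < Re s < m`. -/
theorem rieszFactor_smul_positionIntegral (ω : SchwartzForm n k) {m : ℕ} {D : ℝ}
    (hD : ∀ ξ, ‖(𝓕 ω : SchwartzForm n k) ξ‖ ≤ D * ‖ξ‖ ^ m) {s : ℂ}
    (hs : -(n : ℝ) < s.re) (hs' : s.re < m) (hp : s ∉ rieszPoles) :
    rieszFactor n s • positionIntegral n k s ω
      = frequencyFactor n s • frequencyIntegral n k s ω := by
  set U : Set ℂ := Complex.reLm ⁻¹' Ioo (-(n : ℝ)) m with hU
  have hUo : IsOpen U := isOpen_Ioo.preimage Complex.continuous_re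
  have hUc : IsPreconnected U := ((convex_Ioo _ _).linear_preimage Complex.reLm).isPreconnected
  -- Both sides are divided by `Γ(1 - z/2)`. They become holomorphic on all of the convex strip `U`,
  -- poles included, so the identity theorem carries equality over from `-n < Re z < 0`.
  set f : ℂ → AltForm n k := fun z => ((Real.pi : ℂ) ^ (-(n : ℂ) / 2) * 2 ^ (-z - n + 1) *
    (Complex.Gamma ((z + n) / 2))⁻¹) • positionIntegral n k z ω with hf
  set g : ℂ → AltForm n k := fun z => ((Complex.Gamma (-z / 2 + 1))⁻¹ * frequencyFactor n z) •
    frequencyIntegral n k z ω with hg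
  have hfa : AnalyticOnNhd ℂ f U := by
    refine DifferentiableOn.analyticOnNhd (fun z hz => ?_) hUo
    refine (DifferentiableAt.smul ((differentiable_rieszConst n z).mul
      (differentiable_one_div_Gamma_comp (by fun_prop) z))
      (differentiableAt_positionIntegral ω hz.1)).differentiableWithinAt
  have hga : AnalyticOnNhd ℂ g U := by
    refine DifferentiableOn.analyticOnNhd (fun z hz => ?_) hUo
    refine (DifferentiableAt.smul ((differentiable_one_div_Gamma_comp (by fun_prop) z).mul
      (differentiable_frequencyFactor n z))
      (differentiableAt_frequencyIntegral ω hD hz.2)).differentiableWithinAt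
  have hfg (z : ℂ) (hz : z ∉ rieszPoles) :
      f z = (Complex.Gamma (-z / 2 + 1))⁻¹ • rieszFactor n z • positionIntegral n k z ω := by
    have key (c G H : ℂ) (hG : G ≠ 0) : c * H⁻¹ = G⁻¹ * (c * (G / H)) := by field_simp
    rw [hf, smul_smul, rieszFactor, ← key _ _ _ (Gamma_ne_zero_of_notMem_rieszPoles hz)]
  have hstrip := strip_mem_nhds (n := n) NeZero.one_le
  have hz0 : (-1 / 2 : ℂ) ∈ U := ⟨(mem_of_mem_nhds hstrip).1,
    (mem_of_mem_nhds hstrip).2.trans_le (Nat.cast_nonneg m)⟩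
  have heq : EqOn f g U := hfa.eqOn_of_preconnected_of_eventuallyEq hga hUc hz0 <| by
    filter_upwards [hstrip] with z hz
    rw [hfg z (notMem_rieszPoles_of_re_neg hz.2), rieszFactor_smul_positionIntegral_of_strip ω hz.1 hz.2, smul_smul]
  have h := heq (show s ∈ U from ⟨hs, hs'⟩)
  rw [hfg s hp] at h
  change _ = (_ * _) • _ at h
  rw [mul_smul] at h
  exact smul_right_injective _ (inv_ne_zero (Gamma_ne_zero_of_notMem_rieszPoles hp)) h

theorem exists_fourierCLM (n k : ℕ) :
    ∃ F : SchwartzForm n k →L[ℂ] SchwartzForm n k, ∀ ω, F ω = 𝓕 ω :=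
  ⟨SchwartzMap.fourierTransformCLM ℂ, fun _ => rfl⟩

/-- The Riesz distribution at a single point. -/
theorem exists_rieszCLM (n k : ℕ) [NeZero n] (s : ℂ) :
    ∃ T : SchwartzForm n k →L[ℂ] AltForm n k, (s ∈ rieszPoles → T = 0) ∧
      (s ∉ rieszPoles → -(n : ℝ) < s.re →
        ∀ ω, T ω = rieszFactor n s • positionIntegral n k s ω) ∧
      (s.re < 0 → ∀ ω, T ω = frequencyFactor n s • frequencyIntegral n k s ω) := by
  by_cases hp : s ∈ rieszPoles
  · exact ⟨0, fun _ => rfl, fun h => absurd hp h,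
      fun h => absurd hp (notMem_rieszPoles_of_re_neg h)⟩
  · by_cases hs : -(n : ℝ) < s.re
    · obtain ⟨T, hT⟩ := exists_weightCLM (continuous_quadMap (symbolCoeff n k))
        (norm_quadMap_le _) (z := s - 2) (by simpa using hs)
      refine ⟨rieszFactor n s • T, fun h => absurd h hp, fun _ _ ω => ?_, fun h ω => ?_⟩
      · rw [smul_apply, hT]; rfl
      · rw [smul_apply, hT, ← rieszFactor_smul_positionIntegral_of_strip ω hs h]; rfl
    · have hs0 : s.re < 0 := by
        have : (1 : ℝ) ≤ n := by exact_mod_cast NeZero.one_le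
        linarith
      obtain ⟨T, hT⟩ := exists_weightCLM
        (continuous_fourierSymbol (symbolCoeff n k) (symbolTrace n k) s)
        (norm_fourierSymbol_le _ _ _) (z := -n - s - 2) (by simp; linarith)
      obtain ⟨F, hF⟩ := exists_fourierCLM n k
      refine ⟨frequencyFactor n s • T.comp F, fun h => absurd h hp, fun _ h => absurd h hs,
        fun _ ω => ?_⟩
      rw [smul_apply, ContinuousLinearMap.comp_apply, hF, hT]
      rfl

/-- The position formula defines the family for `Re s > -n`, the frequency formula for `Re s < 0`.
The second clause keeps the frequency formula to the right of the strip, for forms whose Fourier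
transform vanishes sufficiently at the origin; injectivity rests on it. -/
theorem exists_isRieszFamily (n k : ℕ) [NeZero n] :
    ∃ R : ℂ → (SchwartzForm n k →L[ℂ] AltForm n k), IsRieszFamily n k R ∧
      ∀ (s : ℂ) (m : ℕ) (D : ℝ) (ω : SchwartzForm n k), s ∉ rieszPoles → s.re < m →
        (∀ ξ, ‖(𝓕 ω : SchwartzForm n k) ξ‖ ≤ D * ‖ξ‖ ^ m) →
        R s ω = frequencyFactor n s • frequencyIntegral n k s ω := by
  choose R h0 h1 h2 using exists_rieszCLM n k
  have hn : (1 : ℝ) ≤ n := by exact_mod_cast NeZero.one_le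
  refine ⟨R, ⟨fun s hs hs' ω => ?_, fun ω s hs => ?_, fun ω s hs => ?_, h0⟩,
    fun s m D ω hp hm hD => ?_⟩
  · rw [h1 s (notMem_rieszPoles_of_re_neg hs') hs, rieszIntegral_eq]
  · rw [Complex.analyticAt_iff_eventually_differentiableAt]
    rcases lt_or_ge (-(n : ℝ)) s.re with hre | hre
    · have hopen : IsOpen ({z : ℂ | -(n : ℝ) < z.re} ∩ rieszPolesᶜ) :=
        (isOpen_lt continuous_const Complex.continuous_re).inter isClosed_rieszPoles.isOpen_compl
      filter_upwards [hopen.mem_nhds ⟨hre, hs⟩] with z hz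
      refine ((differentiableAt_rieszFactor (n := n) hz.2).smul
        (differentiableAt_positionIntegral ω hz.1)).congr_of_eventuallyEq ?_
      filter_upwards [hopen.mem_nhds hz] with w hw
      exact h1 w hw.2 hw.1 ω
    · have hopen : IsOpen {z : ℂ | z.re < 0} := isOpen_lt Complex.continuous_re continuous_const
      obtain ⟨D, hD⟩ := exists_schwartz_bound (𝓕 ω : SchwartzForm n k) 0
      filter_upwards [hopen.mem_nhds (show s.re < 0 by linarith)] with z hz
      refine ((differentiable_frequencyFactor n z).smul
        (differentiableAt_frequencyIntegral ω (m := 0) (D := D) (by simpa using hD)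
          (by simpa using hz))).congr_of_eventuallyEq ?_
      filter_upwards [hopen.mem_nhds hz] with w hw
      exact h2 w hw ω
  · have hre : -(n : ℝ) < s.re := by
      obtain ⟨m, rfl⟩ := hs
      simp
      linarith [(Nat.cast_nonneg m : (0 : ℝ) ≤ m)]
    have hopen : IsOpen {z : ℂ | -(n : ℝ) < z.re} := isOpen_lt continuous_const Complex.continuous_re
    have hpos : AnalyticAt ℂ (fun z => positionIntegral n k z ω) s := by
      rw [Complex.analyticAt_iff_eventually_differentiableAt]
      filter_upwards [hopen.mem_nhds hre] with z hz
      exact differentiableAt_positionIntegral ω hz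
    refine ((meromorphicAt_rieszFactor (n := n) s).smul hpos.meromorphicAt).congr ?_
    filter_upwards [eventually_nhdsWithin_notMem_rieszPoles s,
      mem_nhdsWithin_of_mem_nhds (hopen.mem_nhds hre)] with z hz hz'
    exact (h1 z hz hz' ω).symm
  · rcases lt_or_ge (-(n : ℝ)) s.re with hre | hre
    · rw [h1 s hp hre, rieszFactor_smul_positionIntegral ω hD hre hm hp]
    · exact h2 s (by linarith) ω

omit [NeZero n] in
-- The complement of a countable set in the plane is connected, so the strip determines the family
-- off the poles; at the poles the value is fixed by convention.
theorem IsRieszFamily.unique (hn : 1 ≤ n) {R R' : ℂ → (SchwartzForm n k →L[ℂ] AltForm n k)}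
    (h : IsRieszFamily n k R) (h' : IsRieszFamily n k R') : R = R' := by
  ext1 s
  by_cases hs : s ∈ rieszPoles
  · rw [h.eq_zero s hs, h'.eq_zero s hs]
  ext1 ω
  have hc : IsPreconnected rieszPolesᶜ :=
    (countable_rieszPoles.isPathConnected_compl_of_one_lt_rank
      (by rw [Complex.rank_real_complex]; norm_num)).isConnected.isPreconnected
  have hstrip := strip_mem_nhds hn
  have hz0 : (-1 / 2 : ℂ) ∈ rieszPolesᶜ :=
    notMem_rieszPoles_of_re_neg (mem_of_mem_nhds hstrip).2
  refine AnalyticOnNhd.eqOn_of_preconnected_of_eventuallyEq (f := fun z => R z ω)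
    (g := fun z => R' z ω) (fun z hz => h.analyticAt ω z hz) (fun z hz => h'.analyticAt ω z hz)
    hc hz0 ?_ hs
  filter_upwards [hstrip] with z hz
  rw [h.eq_integral z hz.1 hz.2, h'.eq_integral z hz.1 hz.2]

end RieszFamily

/-! ### Injectivity of the convolution -/

section Injectivity

open MeasureTheory Set Filter Topology FourierTransform

section Fourier

variable {n : ℕ} {V : Type*} [NormedAddCommGroup V] [NormedSpace ℂ V]

/-- The Fourier transform is injective on integrable functions. -/
theorem ae_eq_zero_of_fourier_eq_zero [CompleteSpace V] {h : Eucl n → V} (hi : Integrable h)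
    (h0 : ∀ x, 𝓕 h x = 0) : ∀ᵐ ξ, h ξ = 0 := by
  refine ae_eq_zero_of_integral_contDiff_smul_eq_zero hi.locallyIntegrable fun g hg hgc => ?_
  have hg₁ : HasCompactSupport (Complex.ofRealCLM ∘ g) := hgc.comp_left rfl
  have hg₂ : ContDiff ℝ ((⊤ : ℕ∞) : WithTop ℕ∞) (Complex.ofRealCLM ∘ g) := by fun_prop
  -- Writing the test function as `𝓕 (𝓕⁻ G)` moves the Fourier transform onto `h`, where it
  -- vanishes.
  set G : 𝓢(Eucl n, ℂ) := hg₁.toSchwartzMap hg₂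
  have hG : 𝓕 (𝓕⁻ G) = G := FourierTransform.fourier_fourierInv_eq G
  have h1 := VectorFourier.integral_fourierIntegral_smul_eq_flip (L := innerₗ (Eucl n))
    (μ := volume) (ν := volume) Real.continuous_fourierChar continuous_inner
    (𝓕⁻ G : 𝓢(Eucl n, ℂ)).integrable hi
  have h2 (x : Eucl n) : VectorFourier.fourierIntegral Real.fourierChar volume
      (innerₗ (Eucl n)).flip h x = 0 := by
    rw [flip_innerₗ]
    exact h0 x
  have h3 (x : Eucl n) : VectorFourier.fourierIntegral Real.fourierChar volume
      (innerₗ (Eucl n)) (𝓕⁻ G : 𝓢(Eucl n, ℂ)) x = (g x : ℂ) :=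
    congrArg (fun F : 𝓢(Eucl n, ℂ) => F x) hG
  simp only [h2, h3, smul_zero, integral_zero] at h1
  simpa using h1

theorem fourier_compSubConst (φ : 𝓢(Eucl n, V)) (v ξ : Eucl n) :
    (𝓕 (φ.compSubConstCLM ℂ v) : 𝓢(Eucl n, V)) ξ
      = (Real.fourierChar (-inner ℝ v ξ) : ℂ) • (𝓕 φ : 𝓢(Eucl n, V)) ξ := by
  have h := congrFun (VectorFourier.fourierIntegral_comp_add_right Real.fourierChar volume
    (innerₗ (Eucl n)) φ (-v)) ξ
  have e : ((SchwartzMap.compSubConstCLM ℂ v φ : 𝓢(Eucl n, V)) : Eucl n → V)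
      = (φ : Eucl n → V) ∘ fun y => y + -v := by
    ext y
    simp [sub_eq_add_neg]
  rw [SchwartzMap.fourier_coe, SchwartzMap.fourier_coe, e]
  simpa [inner_neg_left, Circle.smul_def] using! h

/-- The difference operator `φ ↦ φ (· - v) - φ`. -/
def diffOp (v : Eucl n) (φ : 𝓢(Eucl n, V)) : 𝓢(Eucl n, V) := φ.compSubConstCLM ℂ v - φ

theorem fourier_diffOp (φ : 𝓢(Eucl n, V)) (v ξ : Eucl n) :
    (𝓕 (diffOp v φ) : 𝓢(Eucl n, V)) ξ
      = ((Real.fourierChar (-inner ℝ v ξ) : ℂ) - 1) • (𝓕 φ : 𝓢(Eucl n, V)) ξ := by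
  have h : (𝓕 (diffOp v φ) : 𝓢(Eucl n, V)) = 𝓕 (φ.compSubConstCLM ℂ v) - 𝓕 φ :=
    map_sub (SchwartzMap.fourierTransformCLM ℂ) _ _
  rw [h, sub_apply, fourier_compSubConst, sub_smul, one_smul]

theorem fourier_iterate_diffOp (φ : 𝓢(Eucl n, V)) (v ξ : Eucl n) (m : ℕ) :
    (𝓕 ((diffOp v)^[m] φ) : 𝓢(Eucl n, V)) ξ
      = ((Real.fourierChar (-inner ℝ v ξ) : ℂ) - 1) ^ m • (𝓕 φ : 𝓢(Eucl n, V)) ξ := by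
  induction m with
  | zero => simp
  | succ m ih => rw [Function.iterate_succ_apply', fourier_diffOp, ih, smul_smul, pow_succ']

theorem norm_fourierChar_sub_one_le (v ξ : Eucl n) :
    ‖(Real.fourierChar (-inner ℝ v ξ) : ℂ) - 1‖ ≤ 2 * Real.pi * ‖v‖ * ‖ξ‖ := by
  rw [Real.fourierChar_apply, mul_comm _ Complex.I]
  refine (Real.norm_exp_I_mul_ofReal_sub_one_le).trans ?_
  rw [Real.norm_eq_abs, abs_mul, abs_neg, abs_of_pos (by positivity), mul_assoc _ ‖v‖]
  exact mul_le_mul_of_nonneg_left (abs_real_inner_le_norm v ξ) (by positivity)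

omit [NormedSpace ℂ V] in
theorem eq_zero_of_ae_eq_zero [NeZero n] {f : Eucl n → V} (hf : Continuous f)
    (h : ∀ᵐ ξ, f ξ = 0) : f = 0 :=
  (Continuous.ae_eq_iff_eq volume hf continuous_const).1 h

end Fourier

variable {n k : ℕ}

/-- With `c = n - 2k`, the product of `c‖ξ‖² - (n + s)σ` and its conjugate `c‖ξ‖² + (n + s)σ` is the
scalar `(c² - (n + s)²)‖ξ‖⁴`, since `σ² = ‖ξ‖⁴`. -/
theorem fourierSymbol_injective {s : ℂ} {ξ : Eucl n} (hξ : ξ ≠ 0)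
    (h1 : symbolTrace n k ≠ n + s) (h2 : symbolTrace n k ≠ -(n + s)) {v : AltForm n k}
    (hv : fourierSymbol (symbolCoeff n k) (symbolTrace n k) s ξ v = 0) : v = 0 := by
  have h0 : (‖ξ‖ : ℂ) ≠ 0 := by simpa using hξ
  set c := symbolTrace n k
  set r := (‖ξ‖ : ℂ)
  rw [fourierSymbol_apply] at hv
  set w := quadMap (symbolCoeff n k) ξ v with hw
  have hw2 : quadMap (symbolCoeff n k) ξ w = r ^ 4 • v := symbol_symbol ξ v
  have h3 : (c * r ^ 2) • w - (n + s) • (r ^ 4 • v) = 0 := by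
    have := congrArg (quadMap (symbolCoeff n k) ξ) hv
    rwa [map_sub, map_smul, map_smul, map_zero, hw2, ← hw] at this
  have h4 : ((c - (n + s)) * (c + (n + s)) * r ^ 4) • v = 0 := by
    have e : ((c - (n + s)) * (c + (n + s)) * r ^ 4) • v
        = (c * r ^ 2) • ((c * r ^ 2) • v - (n + s) • w)
          + (n + s) • ((c * r ^ 2) • w - (n + s) • (r ^ 4 • v)) := by module
    have z (c : ℂ) : c • (0 : AltForm n k) = 0 := smul_zero (A := AltForm n k) c
    rw [e, hv, h3, z, z, add_zero]
  refine (smul_eq_zero.1 h4).resolve_left ?_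
  exact mul_ne_zero (mul_ne_zero (sub_ne_zero.2 h1) fun h => h2 (eq_neg_of_add_eq_zero_left h))
    (pow_ne_zero _ h0)

/-- A Riesz distribution with invertible symbol that annihilates all translates of a Schwartz form
annihilates only the zero form. -/
theorem eq_zero_of_forall_translate_eq_zero [NeZero n] {s : ℂ}
    (h1 : symbolTrace n k ≠ n + s) (h2 : symbolTrace n k ≠ -(n + s))
    {T : SchwartzForm n k →L[ℂ] AltForm n k}
    (hT : ∀ (m : ℕ) (D : ℝ) (ω : SchwartzForm n k), s.re < m →
        (∀ ξ, ‖(𝓕 ω : SchwartzForm n k) ξ‖ ≤ D * ‖ξ‖ ^ m) →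
        T ω = frequencyFactor n s • frequencyIntegral n k s ω)
    {φ : SchwartzForm n k} (hφ : ∀ x, T (φ.compSubConstCLM ℂ x) = 0) : φ = 0 := by
  -- An `m`-fold difference multiplies the Fourier transform by a factor of size `O(‖ξ‖ ^ m)`, and
  -- `m > Re s` makes the frequency integral converge at the origin.
  obtain ⟨m, hm⟩ := exists_nat_gt s.re
  have hdiff (v : Eucl n) (j : ℕ) (x : Eucl n) :
      T (((diffOp v)^[j] φ).compSubConstCLM ℂ x) = 0 := by
    induction j generalizing x with
    | zero => exact hφ x
    | succ j ih =>
      rw [Function.iterate_succ_apply', diffOp, map_sub, map_sub, SchwartzMap.compSubConstCLM_comp,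
        ih, ih, sub_zero]
  obtain ⟨C, hC⟩ := exists_schwartz_bound (𝓕 φ : SchwartzForm n k) 0
  simp only [pow_zero, one_mul] at hC
  have hC0 : 0 ≤ C := (norm_nonneg _).trans (hC 0)
  have hzero (v ξ : Eucl n) :
      (𝓕 ((diffOp v)^[m] φ) : SchwartzForm n k) ξ = 0 := by
    set ψ := (diffOp v)^[m] φ with hψ
    have hb (ξ : Eucl n) : ‖(𝓕 ψ : SchwartzForm n k) ξ‖
        ≤ ((2 * Real.pi * ‖v‖) ^ m * C) * ‖ξ‖ ^ m := by
      rw [hψ, fourier_iterate_diffOp, norm_smul, norm_pow]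
      calc _ ≤ (2 * Real.pi * ‖v‖ * ‖ξ‖) ^ m * C := by
            gcongr
            · exact norm_fourierChar_sub_one_le v ξ
            · exact hC ξ
        _ = _ := by ring
    have hb' (x ξ : Eucl n) : ‖(𝓕 (ψ.compSubConstCLM ℂ x) : SchwartzForm n k) ξ‖
        ≤ ((2 * Real.pi * ‖v‖) ^ m * C) * ‖ξ‖ ^ m := by
      rw [fourier_compSubConst, norm_smul, Circle.norm_coe, one_mul]
      exact hb ξ
    set h : Eucl n → AltForm n k := fun ξ => (‖ξ‖ : ℂ) ^ (-n - s - 2) •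
      fourierSymbol (symbolCoeff n k) (symbolTrace n k) s ξ ((𝓕 ψ : SchwartzForm n k) ξ) with hh
    have hint : Integrable h :=
      (isRapid_clm_apply (continuous_fourierSymbol _ _ _) (norm_fourierSymbol_le _ _ _)
        (𝓕 ψ) hb).integrable_cpow_smul (by simp; linarith)
    -- Translation by `x` inserts the character at `-⟨x, ξ⟩`, so pairing with all translates of `ψ`
    -- computes the full Fourier transform of `h`.
    have hF (x : Eucl n) : 𝓕 h x = 0 := by
      have h3 := hT m _ _ hm (hb' x)
      rw [hdiff v m x] at h3
      have h4 := ((smul_eq_zero (M := AltForm n k)).1 h3.symm).resolve_left (frequencyFactor_ne_zero n s)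
      rw [← h4, frequencyIntegral, Real.fourier_eq]
      refine integral_congr_ae (Eventually.of_forall fun ξ => ?_)
      simp only [hh, fourier_compSubConst, map_smul]
      rw [Circle.smul_def, smul_comm, real_inner_comm]
    have hae : ∀ᵐ ξ, (𝓕 ψ : SchwartzForm n k) ξ = 0 := by
      filter_upwards [ae_eq_zero_of_fourier_eq_zero hint hF, ae_ne_zero] with ξ hξ hξ0
      have h5 : (‖ξ‖ : ℂ) ^ (-n - s - 2) ≠ 0 := by
        simp [Complex.cpow_eq_zero_iff, hξ0]
      exact fourierSymbol_injective hξ0 h1 h2 ((smul_eq_zero.1 hξ).resolve_left h5)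
    exact congrFun (eq_zero_of_ae_eq_zero (𝓕 ψ : SchwartzForm n k).continuous hae) ξ
  have hφ0 : ∀ᵐ ξ, (𝓕 φ : SchwartzForm n k) ξ = 0 := by
    filter_upwards [ae_ne_zero] with ξ hξ
    have h0 : ‖ξ‖ ≠ 0 := norm_ne_zero_iff.2 hξ
    -- This step has inner product `1/2` with `ξ`, so the difference multiplier at `ξ` is `-1 - 1 =
    -- -2`, whose `m`-th power is nonzero.
    have h3 := hzero ((1 / (2 * ‖ξ‖ ^ 2)) • ξ) ξ
    have h4 : (Real.fourierChar (-inner ℝ ((1 / (2 * ‖ξ‖ ^ 2)) • ξ) ξ) : ℂ) = -1 := by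
      rw [real_inner_smul_left, real_inner_self_eq_norm_sq, Real.fourierChar_apply]
      have : 2 * Real.pi * -(1 / (2 * ‖ξ‖ ^ 2) * ‖ξ‖ ^ 2) = -Real.pi := by field_simp
      rw [this]
      simp [Complex.exp_neg]
    rw [fourier_iterate_diffOp, h4] at h3
    exact (smul_eq_zero.1 h3).resolve_left (pow_ne_zero _ (by norm_num))
  have hφ1 : (𝓕 φ : SchwartzForm n k) = 0 := by
    ext1 ξ
    exact congrFun (eq_zero_of_ae_eq_zero (𝓕 φ : SchwartzForm n k).continuous hφ0) ξ
  have hinv : 𝓕⁻ (𝓕 φ : SchwartzForm n k) = φ := FourierTransform.fourierInv_fourier_eq φ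
  rw [← hinv, hφ1]
  exact FourierTransform.fourierInv_zero

theorem notMem_rieszPoles {l : ℂ} (hl : ∀ m : ℕ, l ≠ (n : ℂ) + m + 1) :
    -2 * (n : ℂ) + 2 * l ∉ rieszPoles := by
  rintro ⟨m, hm⟩
  exact hl m (by linear_combination hm / 2)

theorem knappStein_injective [NeZero n] {l : ℂ} (h1 : l ≠ k) (h2 : l ≠ (n : ℂ) - k)
    (h3 : ∀ m : ℕ, l ≠ (n : ℂ) + m + 1) : Function.Injective (knappStein n k l) := by
  obtain ⟨R, hR, hrep⟩ := exists_isRieszFamily n k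
  have hex : ∃ R, IsRieszFamily n k R := ⟨R, hR⟩
  have hriesz : riesz n k = R := by
    rw [riesz, dif_pos hex]
    exact hex.choose_spec.unique NeZero.one_le hR
  have hp := notMem_rieszPoles h3
  rw [injective_iff_map_eq_zero]
  intro ω hω
  -- The forms `y ↦ ω (x - y)` are the translates of the reflected form `y ↦ ω (-y)`, to which the
  -- translate criterion applies.
  have h4 : reflTranslate n k 0 ω = 0 := by
    refine eq_zero_of_forall_translate_eq_zero (fun h => h2 ?_) (fun h => h1 ?_)
      (T := R (-2 * (n : ℂ) + 2 * l)) (fun m D η hm hD => hrep _ m D η hp hm hD) fun x => ?_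
    · simp only [symbolTrace] at h
      linear_combination -h / 2
    · simp only [symbolTrace] at h
      linear_combination h / 2
    · have h5 : riesz n k (-2 * (n : ℂ) + 2 * l) (reflTranslate n k x ω) = 0 := congrFun hω x
      rw [hriesz] at h5
      rw [← h5]
      congr 1
      ext1 y
      simp [reflTranslate_apply]
  ext1 x
  have h6 := congrArg (fun η : SchwartzForm n k => η (-x)) h4
  simpa [reflTranslate_apply] using h6

end Injectivity

end KnappSteinForms

end

theorem mainTheorem7 (n k : ℕ) (hn : 1 ≤ n) (hk : k ≤ n) :
    (∃! R : ℂ → (KnappSteinForms.SchwartzForm n k →L[ℂ] KnappSteinForms.AltForm n k),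
      KnappSteinForms.IsRieszFamily n k R) ∧
    ∀ l : ℂ, l ≠ k → l ≠ (n : ℂ) - k → (∀ m : ℕ, l ≠ (n : ℂ) + m + 1) →
      Function.Injective (KnappSteinForms.knappStein n k l) := by
  have : NeZero n := ⟨by omega⟩
  obtain ⟨R, hR, -⟩ := KnappSteinForms.exists_isRieszFamily n k
  exact ⟨⟨R, hR, fun R' hR' => hR'.unique hn hR⟩,
    fun l h1 h2 h3 => KnappSteinForms.knappStein_injective h1 h2 h3⟩
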